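/- **Setting.** Let $n\ge 1$ and let $\mathcal D$ be a compact smooth $n$-dimensional manifold with (possibly empty) boundary and a given smooth positive volume density; for instance the closure of a bounded domain in $\mathbb R^n$ with smooth boundary. Fix $r\in\{1,2,\dots,\infty\}$. Let $\mathfrak X(\mathcal D)$ be the space of $C^r$ vector fields on $\mathcal D$ that are tangent to $\partial\mathcal D$, and let $\mathfrak X(\mathcal D)^*=\Omega^1(\mathcal D)\otimes\mathrm{Den}(\mathcal D)$ be the space of one-form densities, paired with vector fields by $\langle\alpha,\mathbf w\rangle=\int_{\mathcal D}\alpha\cdot\mathbf w$. Let $V^*$ be a vector space of finite families $a=(\rho\,d^nx,a_1,\dots,a_k)$ of $C^1$ tensor field densities of fixed types, the first of which is the mass density. Let $V$ consist of the families of continuous tensor field densities of the dual types, paired with $V^*$ by $\langle v,b\rangle=\int_{\mathcal D}v\cdot b$, the integral of the full contraction. Let $l:\mathfrak X(\mathcal D)\times V^*\to\mathbb R$ be a reduced Lagrangian. Its functional derivatives are fields $\frac{\delta l}{\delta\mathbf u}\in\mathfrak X(\mathcal D)^*$ and $\frac{\delta l}{\delta a}\in V$ with $$\frac{d}{d\varepsilon}\Big|_{0}l(\mathbf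 u+\varepsilon\mathbf w,a)=\Big\langle\frac{\delta l}{\delta\mathbf u},\mathbf w\Big\rangle,\qquad \frac{d}{d\varepsilon}\Big|_{0}l(\mathbf u,a+\varepsilon b)=\Big\langle\frac{\delta l}{\delta a},b\Big\rangle$$ for all $\mathbf w\in\mathfrak X(\mathcal D)$ and $b\in V^*$. For $v\in V$ and $a\in V^*$, $v\diamond a$ is the continuous one-form density with $\langle v\diamond a,\mathbf w\rangle=-\int_{\mathcal D}v\cdot\pounds_{\mathbf w}a$ for all $\mathbf w\in\mathfrak X(\mathcal D)$. Dividing a one-form density $\alpha$ by the mass density gives a one-form $\frac1\rho\alpha$. **Theorem (Kelvin circulation theorem).** Let $J\subseteq\mathbb R$ be open. For $t\in J$ let $\mathbf u_t\in\mathfrak X(\mathcal D)$ and $a_t\in V^*$ be such that $\mathbf u$ and $a$ are jointly $C^1$ in $(t,x)$, the mass density $\rho_t$ vanishes nowhere, and $\frac{\delta l}{\delta\mathbf u}$, $\frac{\delta l}{\delta a}$ at $(\mathbf u_t,a_t)$ and $\frac{\delta l}{\delta a}\diamond a$ exist, with $\frac{\delta l}{\delta\mathbf u}$ jointly $C^1$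 in $(t,x)$. Assume that on $J\times\mathcal D$ the Euler–Poincaré equations for continua and the advection equations hold: $$\frac{\partial}{\partial t}\frac{\delta l}{\delta\mathbf u}=-\pounds_{\mathbf u}\frac{\delta l}{\delta\mathbf u}+\frac{\delta l}{\delta a}\diamond a,\qquad \frac{\partial a}{\partial t}+\pounds_{\mathbf u}a=0 .$$ Then: 1. If $\eta_t$ is a path of $C^r$ diffeomorphisms of $\mathcal D$, jointly $C^1$ in $(t,x)$, with $\frac{d\eta_t}{dt}=\mathbf u_t\circ\eta_t$ for $t\in J$, and if $\gamma_0:S^1\to\mathcal D$ is a continuous, piecewise $C^1$ loop and $\gamma_t:=\eta_t\circ\gamma_0$, then for all $t\in J$ $$\frac{d}{dt}\oint_{\gamma_t}\frac1\rho\frac{\delta l}{\delta\mathbf u}=\oint_{\gamma_t}\frac1\rho\,\frac{\delta l}{\delta a}\diamond a .$$ 2. At every point of $J\times\mathcal D$, $$\Big(\frac{\partial}{\partial t}+\pounds_{\mathbf u}\Big)\Big(\frac1\rho\frac{\delta l}{\delta\mathbf u}\Big)=\frac1\rho\,\frac{\delta l}{\delta a}\diamond a .$$ -/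

import Mathlib

open scoped Manifold ContDiff

noncomputable section

namespace Continua

/-! ### Linear algebra of tensor densities on `ℝⁿ` -/

/-- The model space `ℝⁿ`. -/
abbrev Model (n : ℕ) : Type := EuclideanSpace ℝ (Fin n)

/-- The type of a tensor density: number of contravariant indices, number of covariant indices and
density weight (weight `0`: ordinary tensors; weight `1`: tensor-valued densities). -/
structure TensorType where
  contra : ℕ
  cov : ℕ
  weight : ℝ

namespace TensorType

/-- Densities, such as the mass density. -/
abbrev density : TensorType := ⟨0, 0, 1⟩

/-- One-forms. -/
abbrev oneForm : TensorType := ⟨0, 1, 0⟩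

/-- One-form densities, the elements of `Ω¹ ⊗ Den`. -/
abbrev oneFormDensity : TensorType := ⟨0, 1, 1⟩

/-- The dual type: the full contraction of a tensor density of type `τ` with one of type `τ.dual`
is a density. -/
abbrev dual (τ : TensorType) : TensorType := ⟨τ.cov, τ.contra, 1 - τ.weight⟩

end TensorType

/-- Tensors with `p` contravariant and `q` covariant indices on `ℝⁿ`, by their components
`T I J = T^{I}_{J}` in the standard basis. A tensor density `T ⊗ |dx¹ ⋯ dxⁿ|^w` is represented by the
components of `T`; the weight `w` enters when coordinates are changed. -/
abbrev Ten (n p q : ℕ) : Type := (Fin p → Fin n) → (Fin q → Fin n) → ℝ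

/-- Tensor densities of type `τ` on `ℝⁿ`. -/
abbrev Fiber (n : ℕ) (τ : TensorType) : Type := Ten n τ.contra τ.cov

/-- The matrix entry `A^i_k`. -/
def entry {n : ℕ} (A : Model n →L[ℝ] Model n) (i k : Fin n) : ℝ := A (EuclideanSpace.single k 1) i

/-- Pull-back of a tensor density by a linear isomorphism `A` with inverse `B`: covariant indices
are contracted with `A`, contravariant ones with `B`, and there is a factor `|det A|^w`. -/
def pull {n : ℕ} (τ : TensorType) (A B : Model n →L[ℝ] Model n) (T : Fiber n τ) : Fiber n τ :=
  fun I J => |LinearMap.det (A : Model n →ₗ[ℝ] Model n)| ^ τ.weight *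
    ∑ I' : Fin τ.contra → Fin n, ∑ J' : Fin τ.cov → Fin n,
      (∏ i, entry B (I i) (I' i)) * (∏ j, entry A (J' j) (J j)) * T I' J'

/-- The infinitesimal pull-back, the derivative at `s = 0` of the pull-back by `exp (s L)`. With
`L^i_k = ∂ₖ w^i` these are the terms of a Lie derivative along `w` that have no derivative of `T`:
`∑ⱼ ∑ₖ L^k_{Jⱼ} T^{I}_{J, Jⱼ → k} - ∑ᵢ ∑ₖ L^{Iᵢ}_k T^{I, Iᵢ → k}_{J} + weight * (tr L) * T^{I}_{J}`. -/
def infPull {n : ℕ} (τ : TensorType) (L : Model n →L[ℝ] Model n) (T : Fiber n τ) : Fiber n τ :=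
  fun I J =>
    (∑ j : Fin τ.cov, ∑ k : Fin n, entry L k (J j) * T I (Function.update J j k))
    - (∑ i : Fin τ.contra, ∑ k : Fin n, entry L (I i) k * T (Function.update I i k) J)
    + τ.weight * (∑ k : Fin n, entry L k k) * T I J

/-- Full contraction `∑ v^J_I a^I_J` of a tensor density of the dual type with one of type `τ`.
The result is a density. -/
def contract {n : ℕ} (τ : TensorType) (v : Fiber n τ.dual) (a : Fiber n τ) : ℝ :=
  ∑ I : Fin τ.contra → Fin n, ∑ J : Fin τ.cov → Fin n, v J I * a I J

/-- The number that represents a density. -/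
def scalar {n : ℕ} (T : Fiber n TensorType.density) : ℝ := T (fun i => i.elim0) (fun j => j.elim0)

/-- The value `∑ αᵢ vⁱ` of a one-form (or of a one-form density) on a vector. -/
def evalForm {n : ℕ} (α : Ten n 0 1) (v : Model n) : ℝ :=
  ∑ k : Fin n, α (fun i => i.elim0) (fun _ => k) * v k

/-- The components of a tangent vector in the preferred chart at its base point. -/
def toModel {n : ℕ} [NeZero n] {M : Type*} [TopologicalSpace M]
    [ChartedSpace (EuclideanHalfSpace n) M] {x : M} (v : TangentSpace (𝓡∂ n) x) : Model n := v

/-! ### Tensor density fields on a manifold with boundary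

The tangent space at `x` is identified with `ℝⁿ` through the preferred chart at `x`, as in Mathlib;
a tensor density at `x` is given by its components in that chart. -/

section Fields

variable {n : ℕ} [NeZero n] {M : Type*} [TopologicalSpace M]
  [ChartedSpace (EuclideanHalfSpace n) M] [IsManifold (𝓡∂ n) ∞ M]

/-- The components of the tensor density field `T` in the chart around `x₀`, at the point with
coordinates `z`. -/
def localRep (τ : TensorType) (T : M → Fiber n τ) (x₀ : M) (z : Model n) : Fiber n τ :=
  let y := (extChartAt (𝓡∂ n) x₀).symm z
  pull τ (tangentCoordChange (𝓡∂ n) x₀ y y) (tangentCoordChange (𝓡∂ n) y x₀ y) (T y)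

/-- The components of the vector field `w` in the chart around `x₀`, at the point with
coordinates `z`. -/
def localVec (w : M → Model n) (x₀ : M) (z : Model n) : Model n :=
  let y := (extChartAt (𝓡∂ n) x₀).symm z
  tangentCoordChange (𝓡∂ n) y x₀ y (w y)

/-- `T` is a tensor density field of class `C^k`, up to the boundary. -/
def IsField (τ : TensorType) (k : ℕ∞) (T : M → Fiber n τ) : Prop :=
  ∀ x₀ : M, ContDiffOn ℝ k (localRep τ T x₀) (extChartAt (𝓡∂ n) x₀).target

/-- `T`, a time dependent tensor density field, is of class `C¹` jointly in time and space for times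
in `J`, up to the boundary. -/
def IsC1On (τ : TensorType) (J : Set ℝ) (T : ℝ → M → Fiber n τ) : Prop :=
  ∀ x₀ : M, ContDiffOn ℝ 1 (fun q : ℝ × Model n => localRep τ (T q.1) x₀ q.2)
    (J ×ˢ (extChartAt (𝓡∂ n) x₀).target)

/-- The Lie derivative of a tensor density field `T` along a vector field `w`, given at `x` by its
expression `w^k ∂ₖ T + (terms in ∂w)` in the chart at `x`. -/
def lieDeriv (τ : TensorType) (w : M → Model n) (T : M → Fiber n τ) (x : M) : Fiber n τ :=
  let z := extChartAt (𝓡∂ n) x x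
  fderivWithin ℝ (localRep τ T x) (Set.range (𝓡∂ n)) z (localVec w x z)
    + infPull τ (fderivWithin ℝ (localVec w x) (Set.range (𝓡∂ n)) z) (localRep τ T x z)

/-- Division of a one-form density by a density; the result is a one-form. -/
def divDensity (α : M → Fiber n TensorType.oneFormDensity) (ρ : M → Fiber n TensorType.density) :
    M → Fiber n TensorType.oneForm :=
  fun x I J => α x I J / scalar (ρ x)

variable (n M)

/-- A volume density on `M`: a smooth positive density, together with the Borel measure that it
defines (whose expression in a chart has this density with respect to Lebesgue measure). -/
structure VolumeDensity [MeasurableSpace M] where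
  dens : M → Fiber n TensorType.density
  smooth : IsField TensorType.density ⊤ dens
  pos : ∀ x, 0 < scalar (dens x)
  measure : MeasureTheory.Measure M
  measure_eq : ∀ (x₀ : M) (s : Set M), MeasurableSet s → s ⊆ (extChartAt (𝓡∂ n) x₀).source →
    measure s = ∫⁻ z in extChartAt (𝓡∂ n) x₀ '' s,
      ENNReal.ofReal (scalar (localRep TensorType.density dens x₀ z))

variable {n M}

/-- The integral over `M` of a density, given by its components in the preferred charts. -/
def VolumeDensity.integral [MeasurableSpace M] (vol : VolumeDensity n M) (f : M → ℝ) : ℝ :=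
  ∫ x, f x / scalar (vol.dens x) ∂vol.measure

variable (n M)

/-- The space `𝔛(M)` of vector fields of class `C^r` on `M` that are tangent to the boundary. -/
def VecField (r : ℕ∞) :
    Submodule ℝ (ContMDiffSection (𝓡∂ n) (Model n) (r : ℕ∞ω)
      (fun x : M => TangentSpace (𝓡∂ n) x)) where
  carrier := {w | ∀ x : M, (𝓡∂ n).IsBoundaryPoint x → toModel (w x) 0 = 0}
  add_mem' {v w} hv hw x hx := by
    have h1 := hv x hx
    have h2 := hw x hx
    change toModel (v x) 0 + toModel (w x) 0 = 0
    rw [h1, h2, add_zero]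
  zero_mem' x _ := rfl
  smul_mem' c w hw x hx := by
    have h1 := hw x hx
    change c * toModel (w x) 0 = 0
    rw [h1, mul_zero]

variable {n M}

/-- The value of a vector field, in the preferred charts. -/
def vecVal {r : ℕ∞} (w : VecField n M r) : M → Model n := fun x => toModel (w.1 x)

/-- Time dependent vector fields of class `C¹` jointly in time and space for times in `J`. -/
def IsVecC1On (J : Set ℝ) (u : ℝ → M → Model n) : Prop :=
  ContMDiffOn (𝓘(ℝ, ℝ).prod (𝓡∂ n)) (𝓡∂ n).tangent 1
    (fun p : ℝ × M => (⟨p.2, u p.1 p.2⟩ : TangentBundle (𝓡∂ n) M)) (J ×ˢ Set.univ)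

/-! ### Advected quantities, functional derivatives and the diamond operation -/

/-- The types of the advected quantities: the mass density (index `none`) together with any finite
family of tensor densities. -/
abbrev advType {ι : Type*} (ty : ι → TensorType) : Option ι → TensorType
  | none => TensorType.density
  | some i => ty i

variable (n M) in
/-- Families of tensor density fields of the given types. -/
abbrev AdvFields {ι : Type*} (ty : ι → TensorType) : Type _ :=
  ∀ j : Option ι, M → Fiber n (advType ty j)

variable (n M) in
/-- Families of tensor density fields of the dual types. -/
abbrev DualFields {ι : Type*} (ty : ι → TensorType) : Type _ :=
  ∀ j : Option ι, M → Fiber n (advType ty j).dual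

/-- The mass density among the advected quantities. -/
def massDensity {ι : Type*} {ty : ι → TensorType} (a : AdvFields n M ty) :
    M → Fiber n TensorType.density :=
  a none

variable [MeasurableSpace M]

/-- The pairing `⟨α, w⟩ = ∫ α · w` of a one-form density with a vector field. -/
def pairForm (vol : VolumeDensity n M) (α : M → Fiber n TensorType.oneFormDensity)
    (w : M → Model n) : ℝ :=
  vol.integral fun x => evalForm (α x) (w x)

/-- The pairing `⟨v, b⟩ = ∑ ∫ v · b` between dual families of tensor density fields, by integrals
of their contractions. -/
def pairAdv {ι : Type*} [Fintype ι] {ty : ι → TensorType} (vol : VolumeDensity n M)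
    (v : DualFields n M ty) (b : AdvFields n M ty) : ℝ :=
  ∑ j : Option ι, vol.integral fun x => contract (advType ty j) (v j x) (b j x)

/-- `m = δl/δu` at `(u, a)`: the one-form density with
`d/dε l(u + ε w, a) |_{ε = 0} = ⟨m, w⟩` for all vector fields `w`. -/
def IsFunctionalDerivU {ι : Type*} {ty : ι → TensorType} {r : ℕ∞} (vol : VolumeDensity n M)
    {V : Submodule ℝ (AdvFields n M ty)} (l : VecField n M r → V → ℝ)
    (u : VecField n M r) (a : V) (m : M → Fiber n TensorType.oneFormDensity) : Prop :=
  IsField TensorType.oneFormDensity 0 m ∧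
    ∀ w : VecField n M r, HasDerivAt (fun ε : ℝ => l (u + ε • w) a) (pairForm vol m (vecVal w)) 0

/-- `v = δl/δa` at `(u, a)`: a family of fields of the dual types with
`d/dε l(u, a + ε b) |_{ε = 0} = ⟨v, b⟩` for all `b` in the space `V` of advected quantities. -/
def IsFunctionalDerivA {ι : Type*} [Fintype ι] {ty : ι → TensorType} {r : ℕ∞}
    (vol : VolumeDensity n M) {V : Submodule ℝ (AdvFields n M ty)} (l : VecField n M r → V → ℝ)
    (u : VecField n M r) (a : V) (v : DualFields n M ty) : Prop :=
  (∀ j, IsField (advType ty j).dual 0 (v j)) ∧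
    ∀ b : V, HasDerivAt (fun ε : ℝ => l u (a + ε • b)) (pairAdv vol v b.1) 0

/-- `K = v ⋄ a`: the one-form density with `⟨K, w⟩ = - ∫ v · £_w a` for all vector fields `w`. -/
def IsDiamond {ι : Type*} [Fintype ι] {ty : ι → TensorType} (r : ℕ∞) (vol : VolumeDensity n M)
    (v : DualFields n M ty) (a : AdvFields n M ty)
    (K : M → Fiber n TensorType.oneFormDensity) : Prop :=
  IsField TensorType.oneFormDensity 0 K ∧
    ∀ w : VecField n M r,
      pairForm vol K (vecVal w) = - pairAdv vol v (fun j => lieDeriv (advType ty j) (vecVal w) (a j))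

end Fields

/-! ### Flows, loops and circulation -/

section Loops

variable {n : ℕ} [NeZero n] {M : Type*} [TopologicalSpace M]
  [ChartedSpace (EuclideanHalfSpace n) M]

/-- The motion `η`, a `C¹` path of `C^r` diffeomorphisms of `M`, is a flow of the velocity field `u`
for times in `J`: `dηₜ/dt = uₜ ∘ ηₜ`. -/
structure IsFlow {r : ℕ∞} (J : Set ℝ) (u : ℝ → M → Model n)
    (η : ℝ → Diffeomorph (𝓡∂ n) (𝓡∂ n) M M (r : ℕ∞ω)) : Prop where
  contMDiffOn : ContMDiffOn (𝓘(ℝ, ℝ).prod (𝓡∂ n)) (𝓡∂ n) 1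
    (fun p : ℝ × M => η p.1 p.2) (J ×ˢ Set.univ)
  velocity : ∀ t ∈ J, ∀ x : M, HasMFDerivAt 𝓘(ℝ, ℝ) (𝓡∂ n) (fun s : ℝ => η s x) t
    ((1 : ℝ →L[ℝ] ℝ).smulRight (u t (η t x)))

variable (n) in
/-- Continuous, piecewise `C¹` loops: there is a finite set `F` of parameters such that `γ` is `C¹`
(one-sidedly at the end points) on each interval `[b, c] ⊆ [0, 1]` that has no point of `F` in its
interior. -/
def IsLoop (γ : AddCircle (1 : ℝ) → M) : Prop :=
  Continuous γ ∧ ∃ F : Finset ℝ, ∀ b c : ℝ, 0 ≤ b → b < c → c ≤ 1 →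
    (∀ s ∈ F, s ∉ Set.Ioo b c) →
      ContMDiffOn 𝓘(ℝ, ℝ) (𝓡∂ n) 1 (fun s : ℝ => γ (s : AddCircle (1 : ℝ))) (Set.Icc b c)

/-- The velocity of a loop, in the preferred charts. -/
def loopVelocity (γ : AddCircle (1 : ℝ) → M) (s : ℝ) : Model n :=
  toModel (mfderiv 𝓘(ℝ, ℝ) (𝓡∂ n) (fun s : ℝ => γ (s : AddCircle (1 : ℝ))) s (1 : ℝ))

/-- The circulation `∮_γ α` of a one-form around a loop. -/
def circulation (γ : AddCircle (1 : ℝ) → M) (α : M → Fiber n TensorType.oneForm) : ℝ :=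
  ∫ s in (0 : ℝ)..1, evalForm (α (γ (s : AddCircle (1 : ℝ)))) (loopVelocity (n := n) γ s)

end Loops

end Continua

end

/-!
Write `β = m / ρ` for the one-form obtained from the momentum density `m = δl/δu` and the mass
density `ρ`. The circulation theorem has two parts.

*Pointwise.* Both `m` and `ρ` are transported by `∂ₜ + £_u`: the Euler–Poincaré equation says
`(∂ₜ + £_u) m = K`, where `K` is the diamond term, and the advection equation of the mass density
says `(∂ₜ + £_u) ρ = 0`. Since `m = ρ β`, the Leibniz rules for `∂ₜ` and for `£_u`
(`lieDeriv_oneFormDensity_eq`) give `(∂ₜ + £_u) β = K / ρ`. The trace term in the Lie derivative of a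
one-form density is exactly the one in the Lie derivative of a density, so it cancels. This is
`exists_hasDerivAt_divDensity`.

*Transport.* For a loop `γₜ = ηₜ ∘ γ₀` that moves with the flow, put `Γ(t, s) = γₜ(s)`. In a fixed
chart the integrand of the circulation is `B(t, Γ) (∂ₛ Γ)`, where `∂ₜ Γ = U(t, Γ)` and `B`, `U` are the
coordinate expressions of `β`, `u`. Its time derivative is `(∂ₜ B + dB(U))(∂ₛ Γ) + B(dU(∂ₛ Γ))`, which
is `(∂ₜ β + £_u β)(∂ₛ Γ)` (`hasDerivAt_apply_partial`, `evalForm_add_lieDeriv`). The motion is only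
jointly `C¹`, so `∂ₜ ∂ₛ Γ = ∂ₛ ∂ₜ Γ` is not an instance of the symmetry of second derivatives; it
follows from `∂ₜ Γ = U(t, Γ)` being `C¹`, by a mean value argument
(`hasDerivAt_partial_of_hasStrictFDerivAt`). As the integrand is intrinsic (`evalForm_localRep`), a
chart may be chosen near each `(t, s)`: the chart at the point itself gives the value of the
derivative, and a chart on a neighbourhood gives its local boundedness up to the end points of
each `C¹` piece. Compactness of `[0, 1]` then allows differentiation under the integral sign
(`hasDerivAt_integral_of_piecewise`, `hasDerivAt_circulation`).

At boundary points of the manifold, derivatives in space are taken within the half-space, on which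
they are unique; nothing has to be extended beyond the boundary.
-/

namespace Continua

open Set Filter Topology MeasureTheory Interval

/-! ### Mixed partial derivatives and integrals depending on a parameter -/

/-- If `∂ₜ G = H` near `(t, s)` and `H` is strictly differentiable there, then `∂ₜ ∂ₛ G = ∂ₛ H`.
No second derivative of `G` other than `∂ₛ ∂ₜ G` is assumed to exist. -/
theorem hasDerivAt_partial_of_hasStrictFDerivAt {E : Type*} [NormedAddCommGroup E]
    [NormedSpace ℝ E] {G H : ℝ → ℝ → E} {Gs : ℝ → E} {H' : ℝ × ℝ →L[ℝ] E} {t s : ℝ}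
    (hG : ∀ᶠ p : ℝ × ℝ in 𝓝 (t, s), HasDerivAt (fun τ => G τ p.2) (H p.1 p.2) p.1)
    (hGs : ∀ᶠ τ in 𝓝 t, HasDerivAt (fun σ => G τ σ) (Gs τ) s)
    (hH : HasStrictFDerivAt (fun p : ℝ × ℝ => H p.1 p.2) H' (t, s)) :
    HasDerivAt Gs (H' (0, 1)) t := by
  rw [hasDerivAt_iff_isLittleO, Asymptotics.isLittleO_iff]
  intro ε hε
  have h1 := (Asymptotics.isLittleO_iff.1 hH.isLittleO) hε
  rw [nhds_prod_eq] at h1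
  obtain ⟨N, hN, hstrict⟩ := eventually_prod_self_iff'.1 h1
  obtain ⟨δ, hδ, hball⟩ := Metric.eventually_nhds_iff.1 (hG.and hN)
  have hmem : ∀ τ σ : ℝ, |τ - t| < δ → |σ - s| < δ → dist (τ, σ) (t, s) < δ := by
    intro τ σ h2 h3
    rw [Prod.dist_eq, max_lt_iff]
    exact ⟨h2, h3⟩
  -- the mean value inequality in `τ`, whose bound is proportional to `σ - s`
  have hkey : ∀ τ σ : ℝ, |τ - t| < δ → |σ - s| < δ →
      ‖(G τ σ - G τ s - τ • (σ - s) • H' (0, 1)) - (G t σ - G t s - t • (σ - s) • H' (0, 1))‖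
        ≤ ε * |σ - s| * ‖τ - t‖ := by
    intro τ σ hτ hσ
    have hs0 : |s - s| < δ := by simpa using hδ
    have hsub : ∀ τ' ∈ uIcc t τ, |τ' - t| < δ := fun τ' h =>
      (abs_sub_left_of_mem_uIcc h).trans_lt hτ
    refine Convex.norm_image_sub_le_of_norm_hasDerivWithin_le
      (f := fun τ' => G τ' σ - G τ' s - τ' • (σ - s) • H' (0, 1))
      (f' := fun τ' => H τ' σ - H τ' s - (1 : ℝ) • (σ - s) • H' (0, 1))
      (s := uIcc t τ) (fun τ' h => ?_) (fun τ' h => ?_) (convex_uIcc _ _)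
      left_mem_uIcc right_mem_uIcc
    · have ha := (hball (hmem τ' σ (hsub τ' h) hσ)).1
      have hb := (hball (hmem τ' s (hsub τ' h) hs0)).1
      exact ((ha.sub hb).sub ((hasDerivAt_id τ').smul_const _)).hasDerivWithinAt
    · have ha := (hball (hmem τ' σ (hsub τ' h) hσ)).2
      have hb := (hball (hmem τ' s (hsub τ' h) hs0)).2
      have hc := hstrict _ ha _ hb
      have hd : ((τ', σ) : ℝ × ℝ) - (τ', s) = (σ - s) • ((0 : ℝ), (1 : ℝ)) := by
        ext <;> simp
      simp only [hd, map_smul, norm_smul] at hc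
      simpa using hc
  filter_upwards [hGs, Metric.ball_mem_nhds t hδ] with τ hτ hτδ
  have hτδ' : |τ - t| < δ := hτδ
  -- divide `hkey` by `σ - s` and let `σ` tend to `s`
  have hlim := ((hasDerivAt_iff_tendsto_slope.1 hτ).sub
    (hasDerivAt_iff_tendsto_slope.1 hGs.self_of_nhds)).sub_const ((τ - t) • H' (0, 1))
  refine le_of_tendsto hlim.norm ?_
  filter_upwards [self_mem_nhdsWithin, nhdsWithin_le_nhds (Metric.ball_mem_nhds s hδ)]
    with σ hne hσ
  have hne' : σ - s ≠ 0 := sub_ne_zero.2 hne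
  have hk := hkey τ σ hτδ' hσ
  have heq : slope (fun σ => G τ σ) s σ - slope (fun σ => G t σ) s σ - (τ - t) • H' (0, 1)
      = (σ - s)⁻¹ • ((G τ σ - G τ s - τ • (σ - s) • H' (0, 1))
        - (G t σ - G t s - t • (σ - s) • H' (0, 1))) := by
    simp only [slope, vsub_eq_sub, smul_sub]
    rw [smul_comm τ, smul_comm t, inv_smul_smul₀ hne', inv_smul_smul₀ hne', sub_smul]
    abel
  rw [heq, norm_smul, norm_inv, Real.norm_eq_abs]
  calc |σ - s|⁻¹ * _ ≤ |σ - s|⁻¹ * (ε * |σ - s| * ‖τ - t‖) := by gcongr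
    _ = ε * ‖τ - t‖ := by
      have := abs_ne_zero.2 hne'
      field_simp

/-- Around every parameter there is an interval without other break points. -/
theorem exists_gap_of_finset (F : Finset ℝ) (s : ℝ) :
    ∃ d > 0, ∀ r ∈ F, r ∈ Ioo (s - d) (s + d) → r = s := by
  have hcl : ((F.erase s : Finset ℝ) : Set ℝ)ᶜ ∈ 𝓝 s :=
    (F.erase s).finite_toSet.isClosed.isOpen_compl.mem_nhds (by simp)
  obtain ⟨d, hd, hsub⟩ := Metric.mem_nhds_iff.1 hcl
  refine ⟨d, hd, fun r hr hrd => ?_⟩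
  by_contra hne
  rw [Real.ball_eq_Ioo] at hsub
  exact hsub hrd (by simp [hne, hr])

theorem exists_Ioo_disjoint_finset (F : Finset ℝ) {s : ℝ} (hs : s ∈ Ioo (0 : ℝ) 1)
    (hsF : s ∉ F) :
    ∃ b c : ℝ, 0 ≤ b ∧ c ≤ 1 ∧ s ∈ Ioo b c ∧ ∀ r ∈ F, r ∉ Ioo b c := by
  obtain ⟨d, hd, hdF⟩ := exists_gap_of_finset F s
  refine ⟨max 0 (s - d), min 1 (s + d), le_max_left _ _, min_le_left _ _,
    ⟨max_lt hs.1 (by linarith), lt_min hs.2 (by linarith)⟩, fun r hr hrm => hsF ?_⟩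
  have := hdF r hr ⟨(le_max_right _ _).trans_lt hrm.1, hrm.2.trans_le (min_le_right _ _)⟩
  exact this ▸ hr

/-- Differentiation under the integral sign for an integrand that is smooth off finitely many
parameters `s ∈ F`: on every closed interval between break points, the integrand and its
`t`-derivative have to agree, away from the end points and locally, with functions that are
continuous up to the end points. -/
theorem hasDerivAt_integral_of_piecewise {f : ℝ → ℝ → ℝ} {J : Set ℝ} (hJ : IsOpen J)
    (F : Finset ℝ)
    (h : ∀ b c : ℝ, 0 ≤ b → b < c → c ≤ 1 → (∀ s ∈ F, s ∉ Ioo b c) → ∀ t ∈ J, ∀ s ∈ Icc b c,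
      ∃ p q : ℝ × ℝ → ℝ, ContinuousWithinAt p (J ×ˢ Icc b c) (t, s) ∧
        ContinuousWithinAt q (J ×ˢ Icc b c) (t, s) ∧
        ∀ᶠ x : ℝ × ℝ in 𝓝 (t, s), x.1 ∈ J → x.2 ∈ Ioo b c →
          f x.1 x.2 = p x ∧ HasDerivAt (fun τ => f τ x.2) (q x) x.1)
    {t : ℝ} (ht : t ∈ J) :
    HasDerivAt (fun t => ∫ s in (0 : ℝ)..1, f t s)
      (∫ s in (0 : ℝ)..1, deriv (fun τ => f τ s) t) t := by
  have hgap := exists_gap_of_finset F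
  have hopen := fun s (hs : s ∈ Ioo (0 : ℝ) 1) => exists_Ioo_disjoint_finset F hs
  -- local bounds, on one side of a break point
  have hpiece : ∀ b c : ℝ, 0 ≤ b → b < c → c ≤ 1 → (∀ s ∈ F, s ∉ Ioo b c) → ∀ s ∈ Icc b c,
      ∃ C : ℝ, ∀ᶠ x : ℝ × ℝ in 𝓝 (t, s), x.2 ∈ Ioo b c →
        |f x.1 x.2| ≤ C ∧ DifferentiableAt ℝ (fun τ => f τ x.2) x.1 ∧
          |deriv (fun τ => f τ x.2) x.1| ≤ C := by
    intro b c hb hbc hc hF s hs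
    obtain ⟨p, q, hp, hq, hpq⟩ := h b c hb hbc hc hF t ht s hs
    refine ⟨max (|p (t, s)| + 1) (|q (t, s)| + 1), ?_⟩
    have h1 := hp.abs.eventually (eventually_le_nhds (lt_add_one _))
    have h2 := hq.abs.eventually (eventually_le_nhds (lt_add_one _))
    rw [eventually_nhdsWithin_iff] at h1 h2
    have h3 : ∀ᶠ x : ℝ × ℝ in 𝓝 (t, s), x.1 ∈ J :=
      continuous_fst.continuousAt.eventually (hJ.mem_nhds ht)
    filter_upwards [h1, h2, h3, hpq] with x hx1 hx2 hx3 hx4 hx5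
    have hxm : x ∈ J ×ˢ Icc b c := ⟨hx3, Ioo_subset_Icc_self hx5⟩
    obtain ⟨e1, e2⟩ := hx4 hx3 hx5
    rw [e1, e2.deriv]
    exact ⟨(hx1 hxm).trans (le_max_left _ _), e2.differentiableAt,
      (hx2 hxm).trans (le_max_right _ _)⟩
  have hlocal : ∀ s ∈ Icc (0 : ℝ) 1, ∃ C : ℝ, ∀ᶠ x : ℝ × ℝ in 𝓝 (t, s),
      x.2 ∈ Ioo (0 : ℝ) 1 → x.2 ∉ F →
        |f x.1 x.2| ≤ C ∧ DifferentiableAt ℝ (fun τ => f τ x.2) x.1 ∧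
          |deriv (fun τ => f τ x.2) x.1| ≤ C := by
    intro s hs
    obtain ⟨d, hd, hdF⟩ := hgap s
    have hleft : ∃ C : ℝ, ∀ᶠ x : ℝ × ℝ in 𝓝 (t, s), x.2 ∈ Ioo (0 : ℝ) 1 → x.2 < s →
        |f x.1 x.2| ≤ C ∧ DifferentiableAt ℝ (fun τ => f τ x.2) x.1 ∧
          |deriv (fun τ => f τ x.2) x.1| ≤ C := by
      rcases hs.1.eq_or_lt with h0 | h0
      · exact ⟨0, Eventually.of_forall fun x hx hxs => absurd hx.1 (by linarith)⟩
      · have hlt : max 0 (s - d) < s := max_lt h0 (by linarith)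
        obtain ⟨C, hC⟩ := hpiece (max 0 (s - d)) s (le_max_left _ _) hlt hs.2
          (fun r hr hrm => hrm.2.ne (hdF r hr
            ⟨(le_max_right _ _).trans_lt hrm.1, by linarith [hrm.2]⟩)) s ⟨hlt.le, le_rfl⟩
        refine ⟨C, ?_⟩
        filter_upwards [hC, continuous_snd.continuousAt.eventually (lt_mem_nhds hlt)]
          with x hx1 hx2 _ hx3 using hx1 ⟨hx2, hx3⟩
    have hright : ∃ C : ℝ, ∀ᶠ x : ℝ × ℝ in 𝓝 (t, s), x.2 ∈ Ioo (0 : ℝ) 1 → s < x.2 →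
        |f x.1 x.2| ≤ C ∧ DifferentiableAt ℝ (fun τ => f τ x.2) x.1 ∧
          |deriv (fun τ => f τ x.2) x.1| ≤ C := by
      rcases hs.2.eq_or_lt with h0 | h0
      · exact ⟨0, Eventually.of_forall fun x hx hxs => absurd hx.2 (by linarith)⟩
      · have hlt : s < min 1 (s + d) := lt_min h0 (by linarith)
        obtain ⟨C, hC⟩ := hpiece s (min 1 (s + d)) hs.1 hlt (min_le_left _ _)
          (fun r hr hrm => hrm.1.ne' (hdF r hr
            ⟨by linarith [hrm.1], hrm.2.trans_le (min_le_right _ _)⟩)) s ⟨le_rfl, hlt.le⟩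
        refine ⟨C, ?_⟩
        filter_upwards [hC, continuous_snd.continuousAt.eventually (gt_mem_nhds hlt)]
          with x hx1 hx2 _ hx3 using hx1 ⟨hx3, hx2⟩
    have hmid : ∃ C : ℝ, ∀ᶠ x : ℝ × ℝ in 𝓝 (t, s), x.2 ∈ Ioo (0 : ℝ) 1 → x.2 ∉ F → s = x.2 →
        |f x.1 x.2| ≤ C ∧ DifferentiableAt ℝ (fun τ => f τ x.2) x.1 ∧
          |deriv (fun τ => f τ x.2) x.1| ≤ C := by
      by_cases hsm : s ∈ Ioo (0 : ℝ) 1 ∧ s ∉ F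
      · obtain ⟨b, c, hb, hc, hbc, hF⟩ := hopen s hsm.1 hsm.2
        obtain ⟨C, hC⟩ := hpiece b c hb (hbc.1.trans hbc.2) hc hF s (Ioo_subset_Icc_self hbc)
        refine ⟨C, hC.mono fun x hx _ _ hxs => hx (hxs ▸ hbc)⟩
      · exact ⟨0, Eventually.of_forall fun x hx hxF hxs => absurd (hxs ▸ ⟨hx, hxF⟩) hsm⟩
    obtain ⟨C₁, h1⟩ := hleft
    obtain ⟨C₂, h2⟩ := hright
    obtain ⟨C₃, h3⟩ := hmid
    refine ⟨max C₁ (max C₂ C₃), ?_⟩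
    filter_upwards [h1, h2, h3] with x h1 h2 h3 hx hxF
    rcases lt_trichotomy s x.2 with hlt | heq | hgt
    · obtain ⟨e1, e2, e3⟩ := h2 hx hlt
      exact ⟨by simp [e1], e2, by simp [e3]⟩
    · obtain ⟨e1, e2, e3⟩ := h3 hx hxF heq
      exact ⟨by simp [e1], e2, by simp [e3]⟩
    · obtain ⟨e1, e2, e3⟩ := h1 hx hgt
      exact ⟨by simp [e1], e2, by simp [e3]⟩
  -- a bound that is uniform in `s`, by compactness of `[0, 1]`
  obtain ⟨C, hC⟩ : ∃ C : ℝ, ∀ᶠ τ in 𝓝 t, ∀ s ∈ Icc (0 : ℝ) 1, s ∈ Ioo (0 : ℝ) 1 → s ∉ F →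
      |f τ s| ≤ C ∧ DifferentiableAt ℝ (fun τ => f τ s) τ ∧
        |deriv (fun τ => f τ s) τ| ≤ C := by
    refine isCompact_Icc.induction_on
      (p := fun S => ∃ C : ℝ, ∀ᶠ τ in 𝓝 t, ∀ s ∈ S, s ∈ Ioo (0 : ℝ) 1 → s ∉ F →
        |f τ s| ≤ C ∧ DifferentiableAt ℝ (fun τ => f τ s) τ ∧
          |deriv (fun τ => f τ s) τ| ≤ C) ?_ ?_ ?_ ?_
    · exact ⟨0, Eventually.of_forall fun _ _ h => h.elim⟩
    · rintro S T hST ⟨C, hC⟩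
      exact ⟨C, hC.mono fun τ hτ s hs => hτ s (hST hs)⟩
    · rintro S T ⟨C, hC⟩ ⟨D, hD⟩
      refine ⟨max C D, ?_⟩
      filter_upwards [hC, hD] with τ h1 h2 s hs hs1 hsF
      rcases hs with hs | hs
      · obtain ⟨e1, e2, e3⟩ := h1 s hs hs1 hsF
        exact ⟨by simp [e1], e2, by simp [e3]⟩
      · obtain ⟨e1, e2, e3⟩ := h2 s hs hs1 hsF
        exact ⟨by simp [e1], e2, by simp [e3]⟩
    · intro s hs
      obtain ⟨C, hC⟩ := hlocal s hs
      rw [nhds_prod_eq, eventually_prod_iff] at hC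
      obtain ⟨pa, hpa, pb, hpb, hab⟩ := hC
      exact ⟨{σ | pb σ}, mem_nhdsWithin_of_mem_nhds hpb, C,
        hpa.mono fun τ hτ σ hσ h1 h2 => hab hτ hσ h1 h2⟩
  have hae : ∀ᵐ s : ℝ, s ∈ Ι (0 : ℝ) 1 → s ∈ Icc (0 : ℝ) 1 ∧ s ∈ Ioo (0 : ℝ) 1 ∧ s ∉ F := by
    have h1 : ∀ᵐ s : ℝ, s ∉ (insert 1 F : Finset ℝ) :=
      measure_eq_zero_iff_ae_notMem.1 ((insert 1 F : Finset ℝ).finite_toSet.measure_zero _)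
    filter_upwards [h1] with s hs hs'
    rw [uIoc_of_le zero_le_one] at hs'
    simp only [Finset.mem_insert, not_or] at hs
    exact ⟨⟨hs'.1.le, hs'.2⟩, ⟨hs'.1, lt_of_le_of_ne hs'.2 hs.1⟩, hs.2⟩
  have hmeas : ∀ g : ℝ → ℝ, (∀ s ∈ Ioo (0 : ℝ) 1, s ∉ F → ContinuousAt g s) →
      AEStronglyMeasurable g (volume.restrict (Ι (0 : ℝ) 1)) := by
    intro g hg
    have hS : MeasurableSet (Ioo (0 : ℝ) 1 \ F) :=
      measurableSet_Ioo.diff F.finite_toSet.measurableSet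
    have h1 : AEStronglyMeasurable g (volume.restrict (Ioo (0 : ℝ) 1 \ F)) :=
      ContinuousOn.aestronglyMeasurable
        (fun s hs => (hg s hs.1 hs.2).continuousWithinAt) hS
    refine h1.mono_ac (Measure.absolutelyContinuous_of_le (Measure.restrict_mono_ae ?_))
    filter_upwards [hae] with s hs hs'
    exact ⟨(hs hs').2.1, (hs hs').2.2⟩
  have hcont : ∀ τ ∈ J, ∀ s ∈ Ioo (0 : ℝ) 1, s ∉ F →
      ContinuousAt (f τ) s ∧ ContinuousAt (fun σ => deriv (fun τ' => f τ' σ) τ) s := by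
    intro τ hτ s hs hsF
    obtain ⟨b, c, hb, hc, hbc, hF⟩ := hopen s hs hsF
    obtain ⟨p, q, hp, hq, hpq⟩ :=
      h b c hb (hbc.1.trans hbc.2) hc hF τ hτ s (Ioo_subset_Icc_self hbc)
    have hcurve : Tendsto (fun σ : ℝ => (τ, σ)) (𝓝 s) (𝓝[J ×ˢ Icc b c] (τ, s)) := by
      refine tendsto_nhdsWithin_iff.2 ⟨(Continuous.prodMk_right τ).continuousAt, ?_⟩
      filter_upwards [Ioo_mem_nhds hbc.1 hbc.2] with σ hσ using ⟨hτ, Ioo_subset_Icc_self hσ⟩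
    have heq : ∀ᶠ σ in 𝓝 s, f τ σ = p (τ, σ) ∧
        HasDerivAt (fun τ' => f τ' σ) (q (τ, σ)) τ := by
      have hc0 : ContinuousAt (fun σ : ℝ => (τ, σ)) s := (Continuous.prodMk_right τ).continuousAt
      filter_upwards [hc0.eventually hpq, Ioo_mem_nhds hbc.1 hbc.2] with σ h1 h2 using h1 hτ h2
    constructor
    · exact ContinuousAt.congr (f := fun σ => p (τ, σ)) (hp.tendsto.comp hcurve)
        (heq.mono fun σ h => h.1.symm)
    · exact ContinuousAt.congr (f := fun σ => q (τ, σ)) (hq.tendsto.comp hcurve)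
        (heq.mono fun σ h => h.2.deriv.symm)
  refine (intervalIntegral.hasDerivAt_integral_of_dominated_loc_of_deriv_le
    (F := f) (F' := fun τ s => deriv (fun τ' => f τ' s) τ) (bound := fun _ => C) hC
    ?_ ?_ ?_ ?_ ?_ ?_).2
  · filter_upwards [hJ.mem_nhds ht] with τ hτ
    exact hmeas _ fun s hs hsF => (hcont τ hτ s hs hsF).1
  · refine (intervalIntegrable_const (c := C)).mono_fun
      (hmeas _ fun s hs hsF => (hcont t ht s hs hsF).1) ?_
    refine (ae_restrict_iff' measurableSet_uIoc).2 ?_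
    filter_upwards [hae] with s hs hs'
    obtain ⟨h1, h2, h3⟩ := hs hs'
    exact (hC.self_of_nhds s h1 h2 h3).1.trans (le_abs_self C)
  · exact hmeas _ fun s hs hsF => (hcont t ht s hs hsF).2
  · filter_upwards [hae] with s hs hs' τ hτ
    obtain ⟨h1, h2, h3⟩ := hs hs'
    exact (hτ s h1 h2 h3).2.2
  · exact intervalIntegrable_const
  · filter_upwards [hae] with s hs hs' τ hτ
    obtain ⟨h1, h2, h3⟩ := hs hs'
    exact (hτ s h1 h2 h3).2.1.hasDerivAt

/-! ### Algebra of tensor densities -/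

section Algebra

variable {n : ℕ}

theorem entry_id (i k : Fin n) :
    entry (ContinuousLinearMap.id ℝ (Model n)) i k = if i = k then 1 else 0 := by
  simp [entry]

theorem pull_id (τ : TensorType) (T : Fiber n τ) :
    pull τ (ContinuousLinearMap.id ℝ (Model n)) (ContinuousLinearMap.id ℝ (Model n)) T = T := by
  funext I J
  simp only [pull, entry_id, Fintype.prod_ite_zero, Finset.prod_const_one, ← funext_iff]
  simp

theorem apply_eq_sum_entry (A : Model n →L[ℝ] Model n) (v : Model n) (i : Fin n) :
    A v i = ∑ k, entry A i k * v k := by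
  conv_lhs => rw [← (EuclideanSpace.basisFun (Fin n) ℝ).sum_repr v]
  simp [entry, mul_comm]

/-- Pulling back a one-form is composing it with `A`; the inverse `B` plays no role. -/
theorem evalForm_pull (A B : Model n →L[ℝ] Model n) (T : Fiber n TensorType.oneForm)
    (v : Model n) : evalForm (pull TensorType.oneForm A B T) v = evalForm T (A v) := by
  have h : ∀ k : Fin n, pull TensorType.oneForm A B T (fun i => i.elim0) (fun _ => k)
      = ∑ j : Fin n, entry A j k * T (fun i => i.elim0) (fun _ => j) := by
    intro k
    simp only [pull, Real.rpow_zero, one_mul, Fintype.sum_unique]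
    rw [← (Equiv.funUnique (Fin 1) (Fin n)).symm.sum_comp]
    refine Finset.sum_congr rfl fun j _ => ?_
    simp only [Fin.prod_univ_zero, Fin.prod_univ_one, one_mul]
    rw [Subsingleton.elim (default : Fin 0 → Fin n) (fun i => i.elim0)]
    rfl
  simp only [evalForm, h, apply_eq_sum_entry A v, Finset.sum_mul, Finset.mul_sum]
  rw [Finset.sum_comm]
  exact Finset.sum_congr rfl fun j _ => Finset.sum_congr rfl fun k _ => by ring

/-- The infinitesimal version of `evalForm_pull`. -/
theorem evalForm_infPull (L : Model n →L[ℝ] Model n) (T : Fiber n TensorType.oneForm)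
    (v : Model n) : evalForm (infPull TensorType.oneForm L T) v = evalForm T (L v) := by
  have h : ∀ k : Fin n, infPull TensorType.oneForm L T (fun i => i.elim0) (fun _ => k)
      = ∑ j : Fin n, entry L j k * T (fun i => i.elim0) (fun _ => j) := by
    intro k
    simp only [infPull, Fin.sum_univ_zero, Fin.sum_univ_one, zero_mul, sub_zero, add_zero]
    refine Finset.sum_congr rfl fun j _ => ?_
    congr 2
    funext i
    rw [Subsingleton.elim i 0, Function.update_self]
  simp only [evalForm, h, apply_eq_sum_entry L v, Finset.sum_mul, Finset.mul_sum]
  rw [Finset.sum_comm]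
  exact Finset.sum_congr rfl fun j _ => Finset.sum_congr rfl fun k _ => by ring

theorem scalar_pull (A B : Model n →L[ℝ] Model n) (T : Fiber n TensorType.density) :
    scalar (pull TensorType.density A B T)
      = |LinearMap.det (A : Model n →ₗ[ℝ] Model n)| * scalar T := by
  simp only [scalar, pull, Real.rpow_one, Finset.univ_unique, Finset.sum_singleton,
    Fin.prod_univ_zero, one_mul]
  rw [Subsingleton.elim (default : Fin 0 → Fin n) (fun i => i.elim0)]

theorem scalar_infPull (L : Model n →L[ℝ] Model n) (T : Fiber n TensorType.density) :
    scalar (infPull TensorType.density L T) = (∑ k, entry L k k) * scalar T := by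
  simp [scalar, infPull]

theorem pull_oneFormDensity (A B : Model n →L[ℝ] Model n) (T : Ten n 0 1)
    (I : Fin 0 → Fin n) (K : Fin 1 → Fin n) :
    pull TensorType.oneFormDensity A B T I K
      = |LinearMap.det (A : Model n →ₗ[ℝ] Model n)| * pull TensorType.oneForm A B T I K := by
  simp [pull]

theorem pull_oneForm_div (A B : Model n →L[ℝ] Model n) (T : Ten n 0 1) (c : ℝ)
    (I : Fin 0 → Fin n) (K : Fin 1 → Fin n) :
    pull TensorType.oneForm A B (fun I K => T I K / c) I K
      = pull TensorType.oneForm A B T I K / c := by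
  simp only [pull, mul_div_assoc, Finset.sum_div]

/-- The trace term, by which the infinitesimal pull-back of a one-form density differs from that of
a one-form, appears here as the correction for dividing by a density. -/
theorem infPull_oneForm_div (L : Model n →L[ℝ] Model n) (T : Ten n 0 1) (c : ℝ)
    (I : Fin 0 → Fin n) (K : Fin 1 → Fin n) :
    infPull TensorType.oneForm L (fun I K => T I K / c) I K
      = infPull TensorType.oneFormDensity L T I K / c - (∑ k, entry L k k) * T I K / c := by
  simp only [infPull, Fin.sum_univ_zero, Fin.sum_univ_one, zero_mul, one_mul, sub_zero, add_zero,
    add_div, add_sub_cancel_right, Finset.sum_div, mul_div_assoc', zero_div]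

theorem evalForm_add (α β : Ten n 0 1) (v : Model n) :
    evalForm (α + β) v = evalForm α v + evalForm β v := by
  simp [evalForm, add_mul, Finset.sum_add_distrib]

/-- The value of a one-form on a vector, as a continuous bilinear map. -/
noncomputable def evalFormL (n : ℕ) : Ten n 0 1 →L[ℝ] Model n →L[ℝ] ℝ :=
  LinearMap.toContinuousLinearMap
    { toFun := fun α => LinearMap.toContinuousLinearMap
        { toFun := evalForm α
          map_add' := fun v w => by simp [evalForm, mul_add, Finset.sum_add_distrib]
          map_smul' := fun c v => by
            simp only [evalForm, PiLp.smul_apply, smul_eq_mul, RingHom.id_apply, Finset.mul_sum]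
            exact Finset.sum_congr rfl fun k _ => by ring }
      map_add' := fun α β => by
        ext v
        exact evalForm_add α β v
      map_smul' := fun c α => by
        ext v
        simp [evalForm, Finset.mul_sum, mul_assoc] }

end Algebra

/-! ### Fields in charts -/

section Charts

variable {n : ℕ} [NeZero n] {M : Type*} [TopologicalSpace M]
  [ChartedSpace (EuclideanHalfSpace n) M] [IsManifold (𝓡∂ n) ∞ M]

theorem tangentCoordChange_self_eq_id (x : M) :
    tangentCoordChange (𝓡∂ n) x x x = ContinuousLinearMap.id ℝ (Model n) := by
  ext1 v
  exact tangentCoordChange_self (mem_extChartAt_source x)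

theorem localRep_base (τ : TensorType) (T : M → Fiber n τ) (x : M) :
    localRep τ T x (extChartAt (𝓡∂ n) x x) = T x := by
  simp only [localRep]
  rw [extChartAt_to_inv x, tangentCoordChange_self_eq_id, pull_id]

theorem localVec_base (w : M → Model n) (x : M) :
    localVec w x (extChartAt (𝓡∂ n) x x) = w x := by
  simp only [localVec]
  rw [extChartAt_to_inv x, tangentCoordChange_self_eq_id]
  rfl

theorem tangentCoordChange_comp_inverse {x₀ y : M} (hy : y ∈ (extChartAt (𝓡∂ n) x₀).source)
    (v : Model n) :
    tangentCoordChange (𝓡∂ n) x₀ y y (tangentCoordChange (𝓡∂ n) y x₀ y v) = v := by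
  rw [tangentCoordChange_comp ⟨⟨mem_extChartAt_source y, hy⟩, mem_extChartAt_source y⟩,
    tangentCoordChange_self (mem_extChartAt_source y)]

theorem det_tangentCoordChange_ne_zero {x₀ y : M} (hy : y ∈ (extChartAt (𝓡∂ n) x₀).source) :
    LinearMap.det (tangentCoordChange (𝓡∂ n) x₀ y y : Model n →ₗ[ℝ] Model n) ≠ 0 := by
  have h : (tangentCoordChange (𝓡∂ n) x₀ y y : Model n →ₗ[ℝ] Model n) ∘ₗ
      (tangentCoordChange (𝓡∂ n) y x₀ y : Model n →ₗ[ℝ] Model n) = LinearMap.id := by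
    ext1 v
    exact tangentCoordChange_comp_inverse hy v
  have h1 := congrArg LinearMap.det h
  rw [LinearMap.det_comp, LinearMap.det_id] at h1
  exact left_ne_zero_of_mul_eq_one h1

theorem scalar_localRep_ne_zero {ρ : M → Fiber n TensorType.density}
    (hρ : ∀ x, scalar (ρ x) ≠ 0) {x₀ : M} {z : Model n}
    (hz : z ∈ (extChartAt (𝓡∂ n) x₀).target) :
    scalar (localRep TensorType.density ρ x₀ z) ≠ 0 := by
  simp only [localRep]
  rw [scalar_pull]
  exact mul_ne_zero (abs_ne_zero.2 (det_tangentCoordChange_ne_zero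
    ((extChartAt (𝓡∂ n) x₀).map_target hz))) (hρ _)

theorem localRep_divDensity (α : M → Fiber n TensorType.oneFormDensity)
    (ρ : M → Fiber n TensorType.density) {x₀ : M} {z : Model n}
    (hz : z ∈ (extChartAt (𝓡∂ n) x₀).target) :
    localRep TensorType.oneForm (divDensity α ρ) x₀ z
      = fun I K => localRep TensorType.oneFormDensity α x₀ z I K
          / scalar (localRep TensorType.density ρ x₀ z) := by
  funext I K
  have hdet := abs_ne_zero.2 (det_tangentCoordChange_ne_zero
    ((extChartAt (𝓡∂ n) x₀).map_target hz))
  simp only [localRep]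
  rw [scalar_pull, pull_oneFormDensity, mul_div_mul_left _ _ hdet]
  exact pull_oneForm_div _ _ _ _ I K

/-- The value of a one-form on a tangent vector does not depend on the chart. -/
theorem evalForm_localRep (β : M → Fiber n TensorType.oneForm) {x₀ y : M}
    (hy : y ∈ (extChartAt (𝓡∂ n) x₀).source) (v : Model n) :
    evalForm (localRep TensorType.oneForm β x₀ (extChartAt (𝓡∂ n) x₀ y))
      (tangentCoordChange (𝓡∂ n) y x₀ y v) = evalForm (β y) v := by
  simp only [localRep]
  rw [(extChartAt (𝓡∂ n) x₀).left_inv hy]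
  erw [evalForm_pull]
  rw [tangentCoordChange_comp_inverse hy]

theorem IsC1On.divDensity {J : Set ℝ} {α : ℝ → M → Fiber n TensorType.oneFormDensity}
    {ρ : ℝ → M → Fiber n TensorType.density} (hα : IsC1On TensorType.oneFormDensity J α)
    (hρ : IsC1On TensorType.density J ρ) (hρ0 : ∀ t ∈ J, ∀ x, scalar (ρ t x) ≠ 0) :
    IsC1On TensorType.oneForm J (fun t => divDensity (α t) (ρ t)) := by
  intro x₀
  have h : ContDiffOn ℝ 1 (fun q : ℝ × Model n => fun I K =>
      localRep TensorType.oneFormDensity (α q.1) x₀ q.2 I K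
        / scalar (localRep TensorType.density (ρ q.1) x₀ q.2))
      (J ×ˢ (extChartAt (𝓡∂ n) x₀).target) := by
    refine contDiffOn_pi.2 fun I => contDiffOn_pi.2 fun K => ContDiffOn.div ?_ ?_ ?_
    · exact contDiffOn_pi.1 (contDiffOn_pi.1 (hα x₀) I) K
    · exact contDiffOn_pi.1 (contDiffOn_pi.1 (hρ x₀) _) _
    · exact fun q hq => scalar_localRep_ne_zero (hρ0 q.1 hq.1) hq.2
  exact h.congr fun q hq => localRep_divDensity _ _ hq.2

theorem IsVecC1On.contDiffOn_localVec {J : Set ℝ} {u : ℝ → M → Model n} (hu : IsVecC1On J u)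
    (x₀ : M) : ContDiffOn ℝ 1 (fun q : ℝ × Model n => localVec (u q.1) x₀ q.2)
      (J ×ˢ (extChartAt (𝓡∂ n) x₀).target) := by
  have h1 := hu.mono (prod_mono_right (s := J) (subset_univ (extChartAt (𝓡∂ n) x₀).source))
  have h2 := ((trivializationAt (Model n) (TangentSpace (𝓡∂ n)) x₀).contMDiffOn_iff (fun p hp => by
    rw [TangentBundle.trivializationAt_source]
    have := hp.2
    rwa [extChartAt_source] at this)).1 h1
  have h3 : ContMDiffOn 𝓘(ℝ, ℝ × Model n) (𝓘(ℝ, ℝ).prod (𝓡∂ n)) 1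
      (fun q : ℝ × Model n => (q.1, (extChartAt (𝓡∂ n) x₀).symm q.2))
      (J ×ˢ (extChartAt (𝓡∂ n) x₀).target) := by
    refine ContMDiffOn.prodMk contDiff_fst.contMDiff.contMDiffOn ?_
    exact (contMDiffOn_extChartAt_symm (n := 1) x₀).comp
      contDiff_snd.contMDiff.contMDiffOn (fun q hq => hq.2)
  have h4 := h2.2.comp h3 (fun q hq => ⟨hq.1, (extChartAt (𝓡∂ n) x₀).map_target hq.2⟩)
  exact contMDiffOn_iff_contDiffOn.1 h4

/-- The velocity of a curve in the chart at `x₀`, from its velocity in the preferred charts. -/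
theorem hasDerivAt_extChartAt_comp {c : ℝ → M} {t : ℝ} {v : Model n} {x₀ : M}
    (hc : HasMFDerivAt 𝓘(ℝ, ℝ) (𝓡∂ n) c t ((1 : ℝ →L[ℝ] ℝ).smulRight v))
    (hsrc : c t ∈ (extChartAt (𝓡∂ n) x₀).source) :
    HasDerivAt (fun s => extChartAt (𝓡∂ n) x₀ (c s))
      (tangentCoordChange (𝓡∂ n) (c t) x₀ (c t) v) t := by
  rw [extChartAt_source] at hsrc
  have h := (HasMFDerivAt.comp t (hasMFDerivAt_extChartAt (I := 𝓡∂ n) hsrc) hc)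
  rw [mfderiv_chartAt_eq_tangentCoordChange hsrc] at h
  have h' : HasFDerivAt (fun s => extChartAt (𝓡∂ n) x₀ (c s))
      ((tangentCoordChange (𝓡∂ n) (c t) x₀ (c t)).comp ((1 : ℝ →L[ℝ] ℝ).smulRight v)) t :=
    hasMFDerivAt_iff_hasFDerivAt.1 h
  simpa using h'.hasDerivAt

end Charts

/-! ### Lie derivatives and division by a density -/

theorem hasFDerivWithinAt_component {n p q : ℕ} {f : Model n → Ten n p q}
    {f' : Model n →L[ℝ] Ten n p q} {s : Set (Model n)} {z : Model n}
    (hf : HasFDerivWithinAt f f' s z) (I : Fin p → Fin n) (K : Fin q → Fin n) :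
    HasFDerivWithinAt (fun z => f z I K)
      ((ContinuousLinearMap.proj K).comp ((ContinuousLinearMap.proj I).comp f')) s z :=
  hasFDerivWithinAt_pi'.1 (hasFDerivWithinAt_pi'.1 hf I) K

theorem uniqueDiffWithinAt_range_extChartAt {n : ℕ} [NeZero n] {M : Type*}
    [TopologicalSpace M] [ChartedSpace (EuclideanHalfSpace n) M] (x : M) :
    UniqueDiffWithinAt ℝ (range (𝓡∂ n)) (extChartAt (𝓡∂ n) x x) :=
  (𝓡∂ n).uniqueDiffOn _ (extChartAt_target_subset_range x (mem_extChartAt_target x))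

section Lie

variable {n : ℕ} [NeZero n] {M : Type*} [TopologicalSpace M]
  [ChartedSpace (EuclideanHalfSpace n) M] [IsManifold (𝓡∂ n) ∞ M]

/-- The Leibniz rule for `α = ρ β`, where `ρ` is a density and `β` the one-form `α / ρ`. -/
theorem lieDeriv_oneFormDensity_eq (w : M → Model n)
    {α : M → Fiber n TensorType.oneFormDensity} {ρ : M → Fiber n TensorType.density} {x : M}
    (hρ0 : ∀ x, scalar (ρ x) ≠ 0)
    (hρ : DifferentiableWithinAt ℝ (localRep TensorType.density ρ x) (range (𝓡∂ n))
      (extChartAt (𝓡∂ n) x x))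
    (hβ : DifferentiableWithinAt ℝ (localRep TensorType.oneForm (divDensity α ρ) x)
      (range (𝓡∂ n)) (extChartAt (𝓡∂ n) x x))
    (I : Fin 0 → Fin n) (K : Fin 1 → Fin n) :
    lieDeriv TensorType.oneFormDensity w α x I K
      = scalar (ρ x) * lieDeriv TensorType.oneForm w (divDensity α ρ) x I K
        + divDensity α ρ x I K * scalar (lieDeriv TensorType.density w ρ x) := by
  have hdρ := hasFDerivWithinAt_component hρ.hasFDerivWithinAt (fun i => i.elim0)
    (fun j => j.elim0)
  have hdβ := hasFDerivWithinAt_component hβ.hasFDerivWithinAt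
  -- the product rule for `α = ρ β` in the chart, where `ρ` and `β` are known to be differentiable
  have heq : localRep TensorType.oneFormDensity α x
      =ᶠ[𝓝[range (𝓡∂ n)] (extChartAt (𝓡∂ n) x x)] fun z I K =>
        scalar (localRep TensorType.density ρ x z)
          * localRep TensorType.oneForm (divDensity α ρ) x z I K := by
    filter_upwards [extChartAt_target_mem_nhdsWithin x] with z hz
    rw [localRep_divDensity α ρ hz]
    funext I K
    rw [mul_div_cancel₀ _ (scalar_localRep_ne_zero hρ0 hz)]
  have hdα := HasFDerivWithinAt.congr_of_eventuallyEq (hasFDerivWithinAt_pi.2 fun I =>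
    hasFDerivWithinAt_pi.2 fun K => hdρ.mul (hdβ I K)) heq
      (heq.self_of_nhdsWithin (extChartAt_target_subset_range x (mem_extChartAt_target x)))
  have hα0 : localRep TensorType.oneFormDensity α x (extChartAt (𝓡∂ n) x x) = α x :=
    localRep_base _ _ _
  have hρ1 : localRep TensorType.density ρ x (extChartAt (𝓡∂ n) x x) = ρ x :=
    localRep_base _ _ _
  have hβ0 : localRep TensorType.oneForm (divDensity α ρ) x (extChartAt (𝓡∂ n) x x)
      = fun I K => α x I K / scalar (ρ x) := localRep_base _ _ _
  have hs : ∀ T : Fiber n TensorType.density, T (fun i => i.elim0) (fun j => j.elim0) = scalar T :=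
    fun _ => rfl
  have hadd : ∀ S T : Fiber n TensorType.density, scalar (S + T) = scalar S + scalar T :=
    fun _ _ => rfl
  simp only [lieDeriv]
  rw [hdα.fderivWithin (uniqueDiffWithinAt_range_extChartAt x), hadd, scalar_infPull, hα0, hρ1, hβ0]
  simp only [Pi.add_apply]
  rw [infPull_oneForm_div]
  have := hρ0 x
  simp only [hs, divDensity, ContinuousLinearMap.pi_apply, add_apply, smul_apply,
    ContinuousLinearMap.comp_apply, ContinuousLinearMap.proj_apply,
    smul_eq_mul]
  field_simp
  ring

theorem IsC1On.differentiableWithinAt_localRep {τ : TensorType} {J : Set ℝ}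
    {T : ℝ → M → Fiber n τ} (hT : IsC1On τ J T) {t : ℝ} (ht : t ∈ J) (x : M) :
    DifferentiableWithinAt ℝ (localRep τ (T t) x) (range (𝓡∂ n)) (extChartAt (𝓡∂ n) x x) := by
  have h : ContDiffOn ℝ 1 (localRep τ (T t) x) (extChartAt (𝓡∂ n) x).target :=
    ContDiffOn.comp (g := fun q : ℝ × Model n => localRep τ (T q.1) x q.2)
      (f := fun z : Model n => (t, z)) (hT x) (contDiff_prodMk_right t).contDiffOn
      (fun z hz => ⟨ht, hz⟩)
  exact ((h.differentiableOn one_ne_zero) _ (mem_extChartAt_target x)).mono_of_mem_nhdsWithin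
    (extChartAt_target_mem_nhdsWithin x)

/-- The pointwise form of the circulation theorem: dividing by an advected density commutes with
`∂ₜ + £_u`. -/
theorem exists_hasDerivAt_divDensity {J : Set ℝ} (u : M → Model n)
    {m : ℝ → M → Fiber n TensorType.oneFormDensity} {ρ : ℝ → M → Fiber n TensorType.density}
    {K : M → Fiber n TensorType.oneFormDensity} (hm : IsC1On TensorType.oneFormDensity J m)
    (hρ : IsC1On TensorType.density J ρ) (hρ0 : ∀ t ∈ J, ∀ x, scalar (ρ t x) ≠ 0)
    {t : ℝ} (ht : t ∈ J) (x : M)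
    (hEP : HasDerivAt (fun s => m s x) (-lieDeriv TensorType.oneFormDensity u (m t) x + K x) t)
    (hadv : HasDerivAt (fun s => ρ s x) (-lieDeriv TensorType.density u (ρ t) x) t) :
    ∃ β' : Fiber n TensorType.oneForm,
      HasDerivAt (fun s => divDensity (m s) (ρ s) x) β' t ∧
      β' + lieDeriv TensorType.oneForm u (divDensity (m t) (ρ t)) x
        = divDensity K (ρ t) x := by
  have h1 := fun I K => hasDerivAt_pi.1 (hasDerivAt_pi.1 hEP I) K
  have h2 : HasDerivAt (fun s => scalar (ρ s x))
      (-scalar (lieDeriv TensorType.density u (ρ t) x)) t :=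
    hasDerivAt_pi.1 (hasDerivAt_pi.1 hadv _) _
  refine ⟨_, hasDerivAt_pi.2 fun I => hasDerivAt_pi.2 fun K =>
    (h1 I K).div h2 (hρ0 t ht x), ?_⟩
  funext I K
  have h3 := lieDeriv_oneFormDensity_eq u (hρ0 t ht) (hρ.differentiableWithinAt_localRep ht x)
    ((hm.divDensity hρ hρ0).differentiableWithinAt_localRep ht x) I K
  have := hρ0 t ht x
  simp only [Pi.add_apply, Pi.neg_apply]
  rw [h3]
  simp only [divDensity]
  field_simp
  ring

/-- In the chart at a point, `∂ₜ β + £_u β` appears when the value of `β` on a vector that is carried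
along by `u` is differentiated along the motion. -/
theorem evalForm_add_lieDeriv {J : Set ℝ} (hJ : IsOpen J)
    {β : ℝ → M → Fiber n TensorType.oneForm} {u : ℝ → M → Model n}
    (hβ : IsC1On TensorType.oneForm J β) (hu : IsVecC1On J u) {t : ℝ} (ht : t ∈ J) (x : M)
    {β' : Fiber n TensorType.oneForm} (hβ' : HasDerivAt (fun s => β s x) β' t) (w : Model n) :
    evalForm (fderivWithin ℝ (fun q : ℝ × Model n => localRep TensorType.oneForm (β q.1) x q.2)
          (J ×ˢ (extChartAt (𝓡∂ n) x).target) (t, extChartAt (𝓡∂ n) x x) (1, u t x)) w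
        + evalForm (β t x) (fderivWithin ℝ (fun q : ℝ × Model n => localVec (u q.1) x q.2)
          (J ×ˢ (extChartAt (𝓡∂ n) x).target) (t, extChartAt (𝓡∂ n) x x) (0, w))
      = evalForm (β' + lieDeriv TensorType.oneForm (u t) (β t) x) w := by
  set z := extChartAt (𝓡∂ n) x x with hz
  have hzm : z ∈ (extChartAt (𝓡∂ n) x).target := mem_extChartAt_target x
  have hspace : ∀ {E : Type} [NormedAddCommGroup E] [NormedSpace ℝ E] {f : ℝ × Model n → E},
      ContDiffOn ℝ 1 f (J ×ˢ (extChartAt (𝓡∂ n) x).target) → ∀ v : Model n,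
      fderivWithin ℝ f (J ×ˢ (extChartAt (𝓡∂ n) x).target) (t, z) (0, v)
        = fderivWithin ℝ (fun y => f (t, y)) (range (𝓡∂ n)) z v := by
    intro E _ _ f hf v
    have h1 := ((hf.differentiableOn one_ne_zero) (t, z) ⟨ht, hzm⟩).hasFDerivWithinAt
    have h2 := (h1.comp z (hasFDerivAt_prodMk_right t z).hasFDerivWithinAt
      (fun y hy => ⟨ht, hy⟩ : MapsTo (fun y : Model n => (t, y)) (extChartAt (𝓡∂ n) x).target
        (J ×ˢ (extChartAt (𝓡∂ n) x).target))).mono_of_mem_nhdsWithin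
      (extChartAt_target_mem_nhdsWithin x)
    have h3 := h2.fderivWithin (uniqueDiffWithinAt_range_extChartAt x)
    exact (DFunLike.congr_fun h3 v).symm
  have htime : fderivWithin ℝ (fun q : ℝ × Model n => localRep TensorType.oneForm (β q.1) x q.2)
      (J ×ˢ (extChartAt (𝓡∂ n) x).target) (t, z) (1, 0) = β' := by
    have h1 := (((hβ x).differentiableOn one_ne_zero) (t, z) ⟨ht, hzm⟩).hasFDerivWithinAt
    have h2 := h1.comp_hasDerivAt t ((hasDerivAt_id t).prodMk (hasDerivAt_const t z))
      (show ∀ᶠ s in 𝓝 t, (s, z) ∈ J ×ˢ (extChartAt (𝓡∂ n) x).target from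
        (hJ.eventually_mem ht).mono fun s hs => ⟨hs, hzm⟩)
    refine h2.unique (hβ'.congr_of_eventuallyEq (Eventually.of_forall fun s => ?_))
    exact localRep_base _ _ _
  have hsplit : ((1 : ℝ), u t x) = (1, 0) + (0, u t x) := by simp
  rw [hsplit, map_add, htime, hspace (hβ x), hspace (hu.contDiffOn_localVec x)]
  have hb := localRep_base TensorType.oneForm (β t) x
  have hv := localVec_base (u t) x
  simp only [lieDeriv]
  rw [← hz] at hb hv ⊢
  rw [hb, hv, ← evalForm_infPull, ← evalForm_add, add_assoc]

end Lie

/-! ### Differentiation along a moving curve -/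

/-- Let `∂ₜ G = U(t, G)`. The value of a time dependent one-form `B` on `∂ₛ G` has the `t`-derivative
`(∂ₜ B + dB(U))(∂ₛ G) + B(dU(∂ₛ G))`. The one-form is given through a bilinear map `L`, and `B` and
`U` need only be defined up to the boundary of a domain `S`. -/
theorem hasDerivAt_apply_partial {E F : Type*} [NormedAddCommGroup E] [NormedSpace ℝ E]
    [NormedAddCommGroup F] [NormedSpace ℝ F] (L : F →L[ℝ] E →L[ℝ] ℝ) {S : Set (ℝ × E)}
    {B : ℝ × E → F} {U : ℝ × E → E} (hB : ContDiffOn ℝ 1 B S) (hU : ContDiffOn ℝ 1 U S)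
    {O : Set (ℝ × ℝ)} (hO : IsOpen O) {G : ℝ × ℝ → E} (hG : ContDiffOn ℝ 1 G O)
    (hGS : ∀ x ∈ O, (x.1, G x) ∈ S)
    (hflow : ∀ x ∈ O, HasDerivAt (fun τ => G (τ, x.2)) (U (x.1, G x)) x.1)
    {x : ℝ × ℝ} (hx : x ∈ O) :
    HasDerivAt (fun τ => L (B (τ, G (τ, x.2))) (fderiv ℝ G (τ, x.2) (0, 1)))
      (L (fderivWithin ℝ B S (x.1, G x) (1, U (x.1, G x))) (fderiv ℝ G x (0, 1))
        + L (B (x.1, G x)) (fderivWithin ℝ U S (x.1, G x) (0, fderiv ℝ G x (0, 1)))) x.1 := by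
  have hGdiff : ∀ y ∈ O, HasFDerivAt G (fderiv ℝ G y) y := fun y hy =>
    ((hG.contDiffAt (hO.mem_nhds hy)).differentiableAt one_ne_zero).hasFDerivAt
  have hslice : ∀ᶠ τ in 𝓝 x.1, (τ, x.2) ∈ O :=
    (Continuous.prodMk_left x.2).continuousAt.eventually (hO.mem_nhds hx)
  have h1 : HasDerivAt (fun τ => B (τ, G (τ, x.2)))
      (fderivWithin ℝ B S (x.1, G x) (1, U (x.1, G x))) x.1 :=
    HasFDerivWithinAt.comp_hasDerivAt (f := fun τ : ℝ => (τ, G (τ, x.2))) x.1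
      ((hB.differentiableOn one_ne_zero) _ (hGS x hx)).hasFDerivWithinAt
      ((hasDerivAt_id x.1).prodMk (hflow x hx)) (hslice.mono fun τ hτ => hGS _ hτ)
  -- the mixed partial derivative `∂ₜ ∂ₛ G`, obtained from `∂ₛ` of `∂ₜ G = U(t, G)`
  have h2 : HasDerivAt (fun τ => fderiv ℝ G (τ, x.2) (0, 1))
      (fderivWithin ℝ U S (x.1, G x) (0, fderiv ℝ G x (0, 1))) x.1 := by
    have hH : ContDiffOn ℝ 1 (fun y : ℝ × ℝ => U (y.1, G y)) O :=
      hU.comp (contDiff_fst.contDiffOn.prodMk hG) hGS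
    have hHs := (hH.contDiffAt (hO.mem_nhds hx)).hasStrictFDerivAt one_ne_zero
    have hHd : HasFDerivAt (fun y : ℝ × ℝ => U (y.1, G y))
        ((fderivWithin ℝ U S (x.1, G x)).comp
          ((ContinuousLinearMap.fst ℝ ℝ ℝ).prod (fderiv ℝ G x))) x :=
      HasFDerivWithinAt.comp_hasFDerivAt (f := fun y : ℝ × ℝ => (y.1, G y)) x
        ((hU.differentiableOn one_ne_zero) _ (hGS x hx)).hasFDerivWithinAt
        (hasFDerivAt_fst.prodMk (hGdiff x hx)) ((hO.eventually_mem hx).mono hGS)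
    have h3 := hasDerivAt_partial_of_hasStrictFDerivAt (G := fun τ σ => G (τ, σ))
      (H := fun τ σ => U (τ, G (τ, σ))) (Gs := fun τ => fderiv ℝ G (τ, x.2) (0, 1))
      (t := x.1) (s := x.2) ((hO.eventually_mem hx).mono fun y hy => hflow y hy)
      (hslice.mono fun τ hτ => (hGdiff _ hτ).comp_hasDerivAt x.2
        ((hasDerivAt_const x.2 τ).prodMk (hasDerivAt_id x.2))) hHs
    rw [hHd.fderiv] at h3
    exact h3
  exact (L.hasFDerivAt.comp_hasDerivAt x.1 h1).clm_apply h2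

section Curves

variable {n : ℕ} [NeZero n] {M : Type*} [TopologicalSpace M]
  [ChartedSpace (EuclideanHalfSpace n) M]

/-- The velocity of a curve, in the preferred charts. -/
noncomputable def curveVelocity (c : ℝ → M) (s : ℝ) : Model n :=
  toModel (mfderiv 𝓘(ℝ, ℝ) (𝓡∂ n) c s (1 : ℝ))

variable [IsManifold (𝓡∂ n) ∞ M]

theorem contDiffOn_extChartAt_comp {W : Set (ℝ × ℝ)} {Γ : ℝ → ℝ → M} {x₀ : M}
    (hΓ : ContMDiffOn 𝓘(ℝ, ℝ × ℝ) (𝓡∂ n) 1 (fun x : ℝ × ℝ => Γ x.1 x.2) W)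
    (hW : ∀ x ∈ W, Γ x.1 x.2 ∈ (extChartAt (𝓡∂ n) x₀).source) :
    ContDiffOn ℝ 1 (fun x : ℝ × ℝ => extChartAt (𝓡∂ n) x₀ (Γ x.1 x.2)) W := by
  refine contMDiffOn_iff_contDiffOn.1 ((contMDiffOn_extChartAt (x := x₀)).comp hΓ fun x hx => ?_)
  have := hW x hx
  rwa [extChartAt_source] at this

/-- The velocity of a curve in the chart at `x₀`. -/
theorem fderiv_extChartAt_comp {O : Set (ℝ × ℝ)} (hO : IsOpen O) {Γ : ℝ → ℝ → M} {x₀ : M}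
    (hΓ : ContMDiffOn 𝓘(ℝ, ℝ × ℝ) (𝓡∂ n) 1 (fun x : ℝ × ℝ => Γ x.1 x.2) O)
    (hsrc : ∀ x ∈ O, Γ x.1 x.2 ∈ (extChartAt (𝓡∂ n) x₀).source) {x : ℝ × ℝ} (hx : x ∈ O) :
    fderiv ℝ (fun x : ℝ × ℝ => extChartAt (𝓡∂ n) x₀ (Γ x.1 x.2)) x (0, 1)
      = tangentCoordChange (𝓡∂ n) (Γ x.1 x.2) x₀ (Γ x.1 x.2) (curveVelocity (Γ x.1) x.2) := by
  have hd := (((contDiffOn_extChartAt_comp hΓ hsrc).contDiffAt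
    (hO.mem_nhds hx)).differentiableAt one_ne_zero).hasFDerivAt
  have h1 := HasFDerivAt.comp_hasDerivAt (f := fun σ : ℝ => (x.1, σ)) x.2 hd
    ((hasDerivAt_const x.2 x.1).prodMk (hasDerivAt_id x.2))
  have h2 : MDifferentiableAt 𝓘(ℝ, ℝ) (𝓡∂ n) (Γ x.1) x.2 := by
    have h3 : ContMDiffAt 𝓘(ℝ, ℝ × ℝ) (𝓡∂ n) 1 (fun x : ℝ × ℝ => Γ x.1 x.2) (x.1, x.2) :=
      hΓ.contMDiffAt (hO.mem_nhds hx)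
    have h4 : ContMDiffAt 𝓘(ℝ, ℝ) 𝓘(ℝ, ℝ × ℝ) 1 (fun σ : ℝ => (x.1, σ)) x.2 :=
      (contDiff_prodMk_right x.1).contMDiff.contMDiffAt
    exact (h3.comp x.2 h4).mdifferentiableAt one_ne_zero
  have h5 : HasMFDerivAt 𝓘(ℝ, ℝ) (𝓡∂ n) (Γ x.1) x.2
      ((1 : ℝ →L[ℝ] ℝ).smulRight (curveVelocity (Γ x.1) x.2)) := by
    have h6 : @Eq (ℝ →L[ℝ] Model n) (mfderiv 𝓘(ℝ, ℝ) (𝓡∂ n) (Γ x.1) x.2)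
        ((1 : ℝ →L[ℝ] ℝ).smulRight (curveVelocity (Γ x.1) x.2)) :=
      ContinuousLinearMap.ext_ring (one_smul ℝ (curveVelocity (n := n) (Γ x.1) x.2)).symm
    exact h2.hasMFDerivAt.congr_mfderiv h6
  exact h1.unique (hasDerivAt_extChartAt_comp h5 (hsrc x hx))

/-- The value of a time dependent one-form on the velocity of a curve moving with `u`, and its time
derivative, both in the chart at `x₀`. -/
theorem evalForm_curveVelocity_eq_and_hasDerivAt {J : Set ℝ}
    {β : ℝ → M → Fiber n TensorType.oneForm} {u : ℝ → M → Model n}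
    (hβ : IsC1On TensorType.oneForm J β) (hu : IsVecC1On J u) {O : Set (ℝ × ℝ)} (hO : IsOpen O)
    (hOJ : ∀ x ∈ O, x.1 ∈ J) {Γ : ℝ → ℝ → M} {x₀ : M}
    (hΓ : ContMDiffOn 𝓘(ℝ, ℝ × ℝ) (𝓡∂ n) 1 (fun x : ℝ × ℝ => Γ x.1 x.2) O)
    (hvel : ∀ x ∈ O, HasMFDerivAt 𝓘(ℝ, ℝ) (𝓡∂ n) (fun τ => Γ τ x.2) x.1
      ((1 : ℝ →L[ℝ] ℝ).smulRight (u x.1 (Γ x.1 x.2))))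
    (hsrc : ∀ x ∈ O, Γ x.1 x.2 ∈ (extChartAt (𝓡∂ n) x₀).source)
    {G : ℝ × ℝ → Model n} (hG : G = fun x => extChartAt (𝓡∂ n) x₀ (Γ x.1 x.2))
    {x : ℝ × ℝ} (hx : x ∈ O) :
    evalForm (β x.1 (Γ x.1 x.2)) (curveVelocity (Γ x.1) x.2)
      = evalForm (localRep TensorType.oneForm (β x.1) x₀ (G x)) (fderiv ℝ G x (0, 1)) ∧
    HasDerivAt (fun τ => evalForm (β τ (Γ τ x.2)) (curveVelocity (Γ τ) x.2))
      (evalForm (fderivWithin ℝ (fun q : ℝ × Model n => localRep TensorType.oneForm (β q.1) x₀ q.2)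
          (J ×ˢ (extChartAt (𝓡∂ n) x₀).target) (x.1, G x) (1, localVec (u x.1) x₀ (G x)))
          (fderiv ℝ G x (0, 1))
        + evalForm (localRep TensorType.oneForm (β x.1) x₀ (G x))
          (fderivWithin ℝ (fun q : ℝ × Model n => localVec (u q.1) x₀ q.2)
            (J ×ˢ (extChartAt (𝓡∂ n) x₀).target) (x.1, G x) (0, fderiv ℝ G x (0, 1)))) x.1 := by
  have heq : ∀ y ∈ O, evalForm (β y.1 (Γ y.1 y.2)) (curveVelocity (Γ y.1) y.2)
      = evalForm (localRep TensorType.oneForm (β y.1) x₀ (G y)) (fderiv ℝ G y (0, 1)) := by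
    intro y hy
    rw [hG, fderiv_extChartAt_comp hO hΓ hsrc hy, evalForm_localRep _ (hsrc y hy)]
  refine ⟨heq x hx, ?_⟩
  have hslice : ∀ᶠ τ in 𝓝 x.1, (τ, x.2) ∈ O :=
    (Continuous.prodMk_left x.2).continuousAt.eventually (hO.mem_nhds hx)
  refine HasDerivAt.congr_of_eventuallyEq ?_ (hslice.mono fun τ hτ => heq (τ, x.2) hτ)
  refine hasDerivAt_apply_partial (evalFormL n) (hβ x₀) (hu.contDiffOn_localVec x₀) hO
    (hG ▸ contDiffOn_extChartAt_comp hΓ hsrc) (fun y hy => ⟨hOJ y hy, ?_⟩) (fun y hy => ?_) hx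
  · rw [hG]
    exact (extChartAt (𝓡∂ n) x₀).map_source (hsrc y hy)
  · have h := hasDerivAt_extChartAt_comp (hvel y hy) (hsrc y hy)
    rw [hG]
    simp only [localVec]
    rw [(extChartAt (𝓡∂ n) x₀).left_inv (hsrc y hy)]
    exact h

end Curves

/-! ### Transport of circulations -/

section Circulation

variable {n : ℕ} [NeZero n] {M : Type*} [TopologicalSpace M]
  [ChartedSpace (EuclideanHalfSpace n) M] [IsManifold (𝓡∂ n) ∞ M]

/-- On each `C¹` piece of a moving curve, the circulation integrand and its time derivative extend
continuously to the end points, locally. -/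
theorem exists_continuousWithinAt_evalForm_curveVelocity {J : Set ℝ} (hJ : IsOpen J)
    {β : ℝ → M → Fiber n TensorType.oneForm} {u : ℝ → M → Model n}
    (hβ : IsC1On TensorType.oneForm J β) (hu : IsVecC1On J u) {b c : ℝ} (hbc : b < c)
    {Γ : ℝ → ℝ → M}
    (hΓ : ContMDiffOn 𝓘(ℝ, ℝ × ℝ) (𝓡∂ n) 1 (fun x : ℝ × ℝ => Γ x.1 x.2) (J ×ˢ Icc b c))
    (hvel : ∀ t ∈ J, ∀ s, HasMFDerivAt 𝓘(ℝ, ℝ) (𝓡∂ n) (fun τ => Γ τ s) t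
      ((1 : ℝ →L[ℝ] ℝ).smulRight (u t (Γ t s))))
    {t s : ℝ} (ht : t ∈ J) (hs : s ∈ Icc b c) :
    ∃ p q : ℝ × ℝ → ℝ, ContinuousWithinAt p (J ×ˢ Icc b c) (t, s) ∧
      ContinuousWithinAt q (J ×ˢ Icc b c) (t, s) ∧
      ∀ᶠ x : ℝ × ℝ in 𝓝 (t, s), x.1 ∈ J → x.2 ∈ Ioo b c →
        evalForm (β x.1 (Γ x.1 x.2)) (curveVelocity (Γ x.1) x.2) = p x ∧
          HasDerivAt (fun τ => evalForm (β τ (Γ τ x.2)) (curveVelocity (Γ τ) x.2)) (q x) x.1 := by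
  set x₀ := Γ t s
  -- the chart at `Γ(t, s)` is used on a set `W` that is open in `J × [b, c]`
  obtain ⟨V, hV, hVeq⟩ := continuousOn_iff'.1 hΓ.continuousOn _
    (isOpen_extChartAt_source (I := 𝓡∂ n) x₀)
  have htsV : (t, s) ∈ V := by
    have h : (t, s) ∈ (fun x : ℝ × ℝ => Γ x.1 x.2) ⁻¹' (extChartAt (𝓡∂ n) x₀).source
        ∩ J ×ˢ Icc b c := ⟨mem_extChartAt_source x₀, ht, hs⟩
    rw [hVeq] at h
    exact h.1
  have hsrc : ∀ x ∈ (J ×ˢ Icc b c) ∩ V, Γ x.1 x.2 ∈ (extChartAt (𝓡∂ n) x₀).source := by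
    intro x hx
    have h : x ∈ V ∩ J ×ˢ Icc b c := ⟨hx.2, hx.1⟩
    rw [← hVeq] at h
    exact h.1
  set W := (J ×ˢ Icc b c) ∩ V
  have hWmem : W ∈ 𝓝[J ×ˢ Icc b c] (t, s) := inter_mem self_mem_nhdsWithin
    (mem_nhdsWithin_of_mem_nhds (hV.mem_nhds htsV))
  have htsW : (t, s) ∈ W := ⟨⟨ht, hs⟩, htsV⟩
  have hWu : UniqueDiffOn ℝ W := (hJ.uniqueDiffOn.prod (uniqueDiffOn_Icc hbc)).inter hV
  set G : ℝ × ℝ → Model n := fun x => extChartAt (𝓡∂ n) x₀ (Γ x.1 x.2) with hG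
  set S : Set (ℝ × Model n) := J ×ˢ (extChartAt (𝓡∂ n) x₀).target
  have hSu : UniqueDiffOn ℝ S := hJ.uniqueDiffOn.prod (uniqueDiffOn_extChartAt_target x₀)
  have hGW : ContDiffOn ℝ 1 G W := contDiffOn_extChartAt_comp (hΓ.mono inter_subset_left) hsrc
  have hBS := hβ x₀
  have hUS := hu.contDiffOn_localVec x₀
  set B : ℝ × Model n → Ten n 0 1 := fun q => localRep TensorType.oneForm (β q.1) x₀ q.2
  set U : ℝ × Model n → Model n := fun q => localVec (u q.1) x₀ q.2
  have hgraph : ContinuousOn (fun x : ℝ × ℝ => (x.1, G x)) W :=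
    continuousOn_fst.prodMk hGW.continuousOn
  have hgraphS : MapsTo (fun x : ℝ × ℝ => (x.1, G x)) W S := fun x hx =>
    ⟨hx.1.1, (extChartAt (𝓡∂ n) x₀).map_source (hsrc x hx)⟩
  have hGs : ContinuousOn (fun x => fderivWithin ℝ G W x (0, 1)) W :=
    (hGW.continuousOn_fderivWithin hWu le_rfl).clm_apply continuousOn_const
  have hBc : ContinuousOn (fun x : ℝ × ℝ => evalFormL n (B (x.1, G x))) W :=
    (evalFormL n).continuous.comp_continuousOn (hBS.continuousOn.comp hgraph hgraphS)
  have hUc : ContinuousOn (fun x : ℝ × ℝ => U (x.1, G x)) W :=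
    hUS.continuousOn.comp hgraph hgraphS
  have hDB : ContinuousOn (fun x : ℝ × ℝ => fderivWithin ℝ B S (x.1, G x)) W :=
    (hBS.continuousOn_fderivWithin hSu le_rfl).comp hgraph hgraphS
  have hDU : ContinuousOn (fun x : ℝ × ℝ => fderivWithin ℝ U S (x.1, G x)) W :=
    (hUS.continuousOn_fderivWithin hSu le_rfl).comp hgraph hgraphS
  have hp : ContinuousOn
      (fun x => evalFormL n (B (x.1, G x)) (fderivWithin ℝ G W x (0, 1))) W := hBc.clm_apply hGs
  have hq : ContinuousOn (fun x => evalFormL n (fderivWithin ℝ B S (x.1, G x) (1, U (x.1, G x)))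
        (fderivWithin ℝ G W x (0, 1))
      + evalFormL n (B (x.1, G x))
        (fderivWithin ℝ U S (x.1, G x) (0, fderivWithin ℝ G W x (0, 1)))) W :=
    (((evalFormL n).continuous.comp_continuousOn
      (hDB.clm_apply (continuousOn_const.prodMk hUc))).clm_apply hGs).add
      (hBc.clm_apply (hDU.clm_apply (continuousOn_const.prodMk hGs)))
  refine ⟨_, _, (hp _ htsW).mono_of_mem_nhdsWithin hWmem,
    (hq _ htsW).mono_of_mem_nhdsWithin hWmem, ?_⟩
  -- away from the end points, derivatives within `W` are ordinary ones
  have hO : IsOpen ((J ×ˢ Ioo b c) ∩ V) := (hJ.prod isOpen_Ioo).inter hV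
  have hOW : (J ×ˢ Ioo b c) ∩ V ⊆ W :=
    inter_subset_inter_left _ (prod_mono_right Ioo_subset_Icc_self)
  filter_upwards [hV.mem_nhds htsV] with x hxV hxJ hxI
  have hxO : x ∈ (J ×ˢ Ioo b c) ∩ V := ⟨⟨hxJ, hxI⟩, hxV⟩
  rw [fderivWithin_of_mem_nhds (mem_of_superset (hO.mem_nhds hxO) hOW)]
  exact evalForm_curveVelocity_eq_and_hasDerivAt hβ hu hO (fun y hy => hy.1.1)
    (hΓ.mono (hOW.trans inter_subset_left)) (fun y hy => hvel _ hy.1.1 _)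
    (fun y hy => hsrc y (hOW hy)) hG hxO

/-- The time derivative of the circulation integrand is `∂ₜ β + £_u β`, evaluated on the velocity of
the curve. It is computed in the chart at the point itself, where the Lie derivative is defined. -/
theorem hasDerivAt_evalForm_curveVelocity {J : Set ℝ} (hJ : IsOpen J)
    {β : ℝ → M → Fiber n TensorType.oneForm} {u : ℝ → M → Model n}
    (hβ : IsC1On TensorType.oneForm J β) (hu : IsVecC1On J u) {b c : ℝ} {Γ : ℝ → ℝ → M}
    (hΓ : ContMDiffOn 𝓘(ℝ, ℝ × ℝ) (𝓡∂ n) 1 (fun x : ℝ × ℝ => Γ x.1 x.2) (J ×ˢ Ioo b c))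
    (hvel : ∀ t ∈ J, ∀ s, HasMFDerivAt 𝓘(ℝ, ℝ) (𝓡∂ n) (fun τ => Γ τ s) t
      ((1 : ℝ →L[ℝ] ℝ).smulRight (u t (Γ t s))))
    {t s : ℝ} (ht : t ∈ J) (hs : s ∈ Ioo b c) {β' : Fiber n TensorType.oneForm}
    (hβ' : HasDerivAt (fun τ => β τ (Γ t s)) β' t) :
    HasDerivAt (fun τ => evalForm (β τ (Γ τ s)) (curveVelocity (Γ τ) s))
      (evalForm (β' + lieDeriv TensorType.oneForm (u t) (β t) (Γ t s))
        (curveVelocity (Γ t) s)) t := by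
  have hO : IsOpen ((J ×ˢ Ioo b c) ∩ (fun x : ℝ × ℝ => Γ x.1 x.2) ⁻¹'
      (extChartAt (𝓡∂ n) (Γ t s)).source) :=
    hΓ.continuousOn.isOpen_inter_preimage (hJ.prod isOpen_Ioo) (isOpen_extChartAt_source _)
  have hx : (t, s) ∈ (J ×ˢ Ioo b c) ∩ (fun x : ℝ × ℝ => Γ x.1 x.2) ⁻¹'
      (extChartAt (𝓡∂ n) (Γ t s)).source := ⟨⟨ht, hs⟩, mem_extChartAt_source _⟩
  have h := (evalForm_curveVelocity_eq_and_hasDerivAt hβ hu hO (fun y hy => hy.1.1)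
    (hΓ.mono inter_subset_left) (fun y hy => hvel _ hy.1.1 _) (fun y hy => hy.2) rfl hx).2
  have hw := fderiv_extChartAt_comp hO (hΓ.mono inter_subset_left) (fun y hy => hy.2) hx
  simp only at hw h
  rw [tangentCoordChange_self_eq_id, ContinuousLinearMap.id_apply] at hw
  rw [hw, localVec_base] at h
  rw [← evalForm_add_lieDeriv hJ hβ hu ht (Γ t s) hβ' (curveVelocity (Γ t) s)]
  have hb := localRep_base TensorType.oneForm (β t) (Γ t s)
  rw [hb] at h
  exact h

/-- The transport theorem for circulations around loops that move with a flow. -/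
theorem hasDerivAt_circulation {r : ℕ∞} {J : Set ℝ} (hJ : IsOpen J)
    {β : ℝ → M → Fiber n TensorType.oneForm} {u : ℝ → M → Model n}
    (hβ : IsC1On TensorType.oneForm J β) (hu : IsVecC1On J u)
    {η : ℝ → Diffeomorph (𝓡∂ n) (𝓡∂ n) M M (r : ℕ∞ω)} (hη : IsFlow J u η)
    {γ₀ : AddCircle (1 : ℝ) → M} (hγ : IsLoop n γ₀) {t : ℝ} (ht : t ∈ J)
    {κ : M → Fiber n TensorType.oneForm}
    (hκ : ∀ x, ∃ β' : Fiber n TensorType.oneForm, HasDerivAt (fun s => β s x) β' t ∧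
      β' + lieDeriv TensorType.oneForm (u t) (β t) x = κ x) :
    HasDerivAt (fun s => circulation (η s ∘ γ₀) (β s)) (circulation (η t ∘ γ₀) κ) t := by
  obtain ⟨-, F, hF⟩ := hγ
  set Γ : ℝ → ℝ → M := fun t s => η t (γ₀ (s : AddCircle (1 : ℝ)))
  have hvel : ∀ t ∈ J, ∀ s, HasMFDerivAt 𝓘(ℝ, ℝ) (𝓡∂ n) (fun τ => Γ τ s) t
      ((1 : ℝ →L[ℝ] ℝ).smulRight (u t (Γ t s))) := fun t ht s => hη.velocity t ht _
  have hΓd : ∀ b c : ℝ, 0 ≤ b → b < c → c ≤ 1 → (∀ s ∈ F, s ∉ Ioo b c) →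
      ContMDiffOn 𝓘(ℝ, ℝ × ℝ) (𝓡∂ n) 1 (fun x : ℝ × ℝ => Γ x.1 x.2) (J ×ˢ Icc b c) := by
    intro b c hb hbc hc hFbc
    have h1 : ContMDiffOn 𝓘(ℝ, ℝ × ℝ) (𝓘(ℝ, ℝ).prod (𝓡∂ n)) 1
        (fun x : ℝ × ℝ => (x.1, γ₀ (x.2 : AddCircle (1 : ℝ)))) (J ×ˢ Icc b c) :=
      ContMDiffOn.prodMk contDiff_fst.contMDiff.contMDiffOn
        ((hF b c hb hbc hc hFbc).comp contDiff_snd.contMDiff.contMDiffOn fun x hx => hx.2)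
    exact hη.contMDiffOn.comp h1 fun x hx => ⟨hx.1, mem_univ _⟩
  have h := hasDerivAt_integral_of_piecewise
    (f := fun t s => evalForm (β t (Γ t s)) (curveVelocity (Γ t) s)) hJ F
    (fun b c hb hbc hc hFbc t ht s hs => exists_continuousWithinAt_evalForm_curveVelocity hJ hβ hu
      hbc (hΓd b c hb hbc hc hFbc) hvel ht hs) ht
  have heq : ∫ s in (0 : ℝ)..1, deriv (fun τ => evalForm (β τ (Γ τ s)) (curveVelocity (Γ τ) s)) t
      = circulation (η t ∘ γ₀) κ := by
    -- at the finitely many break points the velocity of the loop may be a junk value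
    refine intervalIntegral.integral_congr_ae ?_
    have h1 : ∀ᵐ s : ℝ, s ∉ (insert 1 F : Finset ℝ) :=
      measure_eq_zero_iff_ae_notMem.1 ((insert 1 F : Finset ℝ).finite_toSet.measure_zero _)
    filter_upwards [h1] with s hs hs'
    rw [uIoc_of_le zero_le_one] at hs'
    simp only [Finset.mem_insert, not_or] at hs
    obtain ⟨b, c, hb, hc, hbc, hFbc⟩ := exists_Ioo_disjoint_finset F
      ⟨hs'.1, lt_of_le_of_ne hs'.2 hs.1⟩ hs.2
    obtain ⟨β', hβ', hκ'⟩ := hκ (Γ t s)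
    rw [(hasDerivAt_evalForm_curveVelocity hJ hβ hu
      ((hΓd b c hb (hbc.1.trans hbc.2) hc hFbc).mono (prod_mono_right Ioo_subset_Icc_self))
      hvel ht hbc hβ').deriv, hκ']
    rfl
  rw [heq] at h
  exact h

end Circulation

end Continua

theorem mainTheorem2 {n : ℕ} [NeZero n] {M : Type*} [TopologicalSpace M] [T2Space M]
    [CompactSpace M] [ChartedSpace (EuclideanHalfSpace n) M] [IsManifold (𝓡∂ n) ∞ M]
    [MeasurableSpace M] [BorelSpace M] (vol : Continua.VolumeDensity n M)
    (r : ℕ∞) (hr : 1 ≤ r)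
    -- the space of advected quantities and the reduced Lagrangian
    {ι : Type*} [Fintype ι] (ty : ι → Continua.TensorType)
    (V : Submodule ℝ (Continua.AdvFields n M ty))
    (hV : ∀ a ∈ V, ∀ j, Continua.IsField (Continua.advType ty j) 1 (a j))
    (l : Continua.VecField n M r → V → ℝ)
    -- velocity, advected quantities, functional derivatives, diamond term
    (J : Set ℝ) (hJ : IsOpen J)
    (u : ℝ → Continua.VecField n M r) (hu : Continua.IsVecC1On J (fun t => Continua.vecVal (u t)))
    (a : ℝ → V)
    (ha : ∀ j, Continua.IsC1On (Continua.advType ty j) J (fun t => (a t).1 j))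
    (hρ : ∀ t ∈ J, ∀ x, Continua.scalar (Continua.massDensity (a t).1 x) ≠ 0)
    (m : ℝ → M → Continua.Fiber n Continua.TensorType.oneFormDensity)
    (hm : ∀ t ∈ J, Continua.IsFunctionalDerivU vol l (u t) (a t) (m t))
    (hm1 : Continua.IsC1On Continua.TensorType.oneFormDensity J m)
    (v : ℝ → Continua.DualFields n M ty)
    (hv : ∀ t ∈ J, Continua.IsFunctionalDerivA vol l (u t) (a t) (v t))
    (K : ℝ → M → Continua.Fiber n Continua.TensorType.oneFormDensity)
    (hK : ∀ t ∈ J, Continua.IsDiamond r vol (v t) (a t).1 (K t))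
    -- the Euler–Poincaré equations
    (hEP : ∀ t ∈ J, ∀ x, HasDerivAt (fun s => m s x)
      (-Continua.lieDeriv Continua.TensorType.oneFormDensity (Continua.vecVal (u t)) (m t) x + K t x) t)
    -- the advection equations
    (hadv : ∀ t ∈ J, ∀ j x, HasDerivAt (fun s => (a s).1 j x)
      (-Continua.lieDeriv (Continua.advType ty j) (Continua.vecVal (u t)) ((a t).1 j) x) t) :
    -- the circulation theorem
    (∀ η : ℝ → Diffeomorph (𝓡∂ n) (𝓡∂ n) M M (r : ℕ∞ω),
      Continua.IsFlow J (fun t => Continua.vecVal (u t)) η →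
      ∀ γ₀ : AddCircle (1 : ℝ) → M, Continua.IsLoop n γ₀ → ∀ t ∈ J,
        HasDerivAt
          (fun s => Continua.circulation (η s ∘ γ₀)
            (Continua.divDensity (m s) (Continua.massDensity (a s).1)))
          (Continua.circulation (η t ∘ γ₀)
            (Continua.divDensity (K t) (Continua.massDensity (a t).1))) t) ∧
    -- its pointwise form
    (∀ t ∈ J, ∀ x, ∃ β' : Continua.Fiber n Continua.TensorType.oneForm,
      HasDerivAt (fun s => Continua.divDensity (m s) (Continua.massDensity (a s).1) x) β' t ∧
      β' + Continua.lieDeriv Continua.TensorType.oneForm (Continua.vecVal (u t))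
          (Continua.divDensity (m t) (Continua.massDensity (a t).1)) x
        = Continua.divDensity (K t) (Continua.massDensity (a t).1) x) := by
  have hpt := fun t (ht : t ∈ J) (x : M) => Continua.exists_hasDerivAt_divDensity
    (Continua.vecVal (u t)) hm1 (ha none) hρ ht x (hEP t ht x) (hadv t ht none x)
  exact ⟨fun η hη γ₀ hγ t ht => Continua.hasDerivAt_circulation hJ
    (hm1.divDensity (ha none) hρ) hu hη hγ ht (hpt t ht), hpt⟩
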